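/- **Theorem 8.3 (hyperrectangles:spectrum).** Let $d\ge 2$, $a_1,\dots,a_d>0$ and $Q=(-a_1,a_1)\times\dots\times(-a_d,a_d)\subset\mathbb R^d$. For $\alpha\in\mathbb C$ let $-\Delta_Q^\alpha$ be the Robin Laplacian, i.e. the operator in $L^2(Q)$ (complex-valued functions) associated with the form $$a_\alpha[u,v]=\int_Q\nabla u\cdot\overline{\nabla v}\,dx+\alpha\int_{\partial Q}u\,\overline v\,d\sigma,\qquad u,v\in H^1(Q)$$ (boundary values in the sense of traces): $u$ is in its domain, with $-\Delta_Q^\alpha u=h\in L^2(Q)$, if and only if $u\in H^1(Q)$ and $a_\alpha[u,v]=\int_Q h\,\overline v\,dx$ for all $v\in H^1(Q)$. Let $0<\varphi<\pi/2$ and let $T_\varphi^-=\{\alpha\in\mathbb C\setminus\{0\}:|\arg(-\alpha)|<\varphi\}$, where $\arg$ is the principal argument. An *eigencurve* is a function $\lambda$ such that, for all $\alpha\in T_\varphi^-$ with $|\alpha|$ large enough, $\lambda$ is analytic at $\alpha$ and $\lambda(\alpha)$ is an eigenvalue of $-\Delta_Q^\alpha$. All limits below are for $\alpha\to\infty$ in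 $T_\varphi^-$, $\lambda(\alpha)\sim c\,\alpha^2$ means $\lambda(\alpha)=c\,\alpha^2+o(\alpha^2)$ (for a constant $c\neq0$), and "eventually" means for all $\alpha\in T_\varphi^-$ with $|\alpha|$ large enough. 1. For each $j=1,\dots,d-1$ there are infinitely many divergent eigencurves with $\lambda(\alpha)\sim -j\alpha^2$: there are eigencurves $\lambda_0,\lambda_1,\lambda_2,\dots$ with $|\lambda_n(\alpha)|\to\infty$ and $\lambda_n(\alpha)\sim-j\alpha^2$ for every $n$, such that for all $m\ne n$ eventually $\lambda_m(\alpha)\neq\lambda_n(\alpha)$. 2. Counted with algebraic multiplicity there are exactly $2^d$ eigenvalues which behave like $-d\alpha^2$: there are eigencurves $\lambda_1,\dots,\lambda_{2^d}$ with $\lambda_i(\alpha)\sim-d\alpha^2$ for every $i$, such that eventually, for every $i$, the algebraic multiplicity of the eigenvalue $\lambda_i(\alpha)$ of $-\Delta_Q^\alpha$ equals the number of indices $k$ with $\lambda_k(\alpha)=\lambda_i(\alpha)$; and if $\mu(\alpha)$ is eventually an eigenvalue of $-\Delta_Q^\alpha$ (not necessarily depending analytically on $\alpha$) with $\mu(\alpha)\sim-d\alpha^2$,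 then eventually $\mu(\alpha)\in\{\lambda_1(\alpha),\dots,\lambda_{2^d}(\alpha)\}$. -/

import Mathlib

open MeasureTheory Filter Topology Asymptotics Bornology
open scoped ContDiff

noncomputable section

namespace RobinBox

/-- The open hyperrectangle `(-a 0, a 0) × ⋯ × (-a (d-1), a (d-1))` in `ℝ^d`. Only coordinates,
Lebesgue measure and smoothness on `ℝ^d` are used below, so `ℝ^d` is `Fin d → ℝ`. -/
def box {d : ℕ} (a : Fin d → ℝ) : Set (Fin d → ℝ) :=
  Set.univ.pi fun i => Set.Ioo (-a i) (a i)

/-- Lebesgue measure on the hyperrectangle. -/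
def boxMeasure {d : ℕ} (a : Fin d → ℝ) : Measure (Fin d → ℝ) :=
  volume.restrict (box a)

/-- The `(d-1)`-dimensional Lebesgue measure on the face `{x | x j = c, |x i| < a i for i ≠ j}`:
the product of a Dirac mass in the coordinate `j` and of Lebesgue measures in the others. -/
def faceMeasure {d : ℕ} (a : Fin d → ℝ) (j : Fin d) (c : ℝ) : Measure (Fin d → ℝ) :=
  Measure.pi (Function.update
    (fun i => (volume : Measure ℝ).restrict (Set.Ioo (-a i) (a i))) j (Measure.dirac c))

/-- Surface measure on the boundary of the hyperrectangle: the sum over its `2 d` faces. -/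
def surfaceMeasure {d : ℕ} (a : Fin d → ℝ) : Measure (Fin d → ℝ) :=
  ∑ j, (faceMeasure a j (-a j) + faceMeasure a j (a j))

/-- Complex `L²` of the hyperrectangle. -/
abbrev L2Box {d : ℕ} (a : Fin d → ℝ) := Lp ℂ 2 (boxMeasure a)

/-- Complex `L²` of the boundary of the hyperrectangle. -/
abbrev L2Bdry {d : ℕ} (a : Fin d → ℝ) := Lp ℂ 2 (surfaceMeasure a)

/-- The `i`-th classical partial derivative. -/
def partialDeriv {d : ℕ} (i : Fin d) (f : (Fin d → ℝ) → ℂ) (x : Fin d → ℝ) : ℂ :=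
  fderiv ℝ f x (Pi.single i 1)

/-- `G` is the weak gradient of `u` on the hyperrectangle. Thus `u ∈ H¹` if and only if there is
`G` (with components in `L²`) such that `HasWeakGradient a u G`. -/
def HasWeakGradient {d : ℕ} (a : Fin d → ℝ) (u : L2Box a) (G : Fin d → L2Box a) : Prop :=
  ∀ f : (Fin d → ℝ) → ℂ, ContDiff ℝ ∞ f → HasCompactSupport f → tsupport f ⊆ box a →
    ∀ i, ∫ x, u x * partialDeriv i f x ∂(boxMeasure a) = -∫ x, G i x * f x ∂(boxMeasure a)

lemma contDiff_partialDeriv {d : ℕ} (i : Fin d) {f : (Fin d → ℝ) → ℂ} (hf : ContDiff ℝ ∞ f) :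
    ContDiff ℝ ∞ (partialDeriv i f) := by
  unfold partialDeriv
  exact (hf.fderiv_right (m := ∞) (by simp)).clm_apply contDiff_const

lemma box_subset {d : ℕ} (a : Fin d → ℝ) : box a ⊆ Set.Icc (-a) a := by
  intro x hx
  exact ⟨fun i => (hx i trivial).1.le, fun i => (hx i trivial).2.le⟩

instance isFiniteMeasure_boxMeasure {d : ℕ} (a : Fin d → ℝ) : IsFiniteMeasure (boxMeasure a) :=
  ⟨by
    rw [boxMeasure, Measure.restrict_apply_univ]
    exact (measure_mono (box_subset a)).trans_lt isCompact_Icc.measure_lt_top⟩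

lemma integrable_mul_continuous {d : ℕ} (a : Fin d → ℝ) (u : L2Box a)
    {f : (Fin d → ℝ) → ℂ} (hf : Continuous f) :
    Integrable (fun x => u x * f x) (boxMeasure a) := by
  have hu : Integrable (fun x => u x) (boxMeasure a) := (Lp.memLp u).integrable (by norm_num)
  obtain ⟨C, hC⟩ := (isCompact_Icc (a := -a) (b := a)).exists_bound_of_continuousOn hf.continuousOn
  refine hu.mul_bdd (c := C) hf.aestronglyMeasurable ?_
  have hm : MeasurableSet (box a) := MeasurableSet.univ_pi fun i => measurableSet_Ioo
  exact (ae_restrict_iff' hm).2 (Eventually.of_forall fun x hx => hC x (box_subset a hx))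

lemma HasWeakGradient.zero {d : ℕ} (a : Fin d → ℝ) : HasWeakGradient a 0 0 := by
  intro f _ _ _ i
  have h : ∀ᵐ x ∂(boxMeasure a), (0 : L2Box a) x = 0 := Lp.coeFn_zero _ _ _
  rw [integral_eq_zero_of_ae, integral_eq_zero_of_ae, neg_zero]
  · filter_upwards [h] with x hx
    change (0 : L2Box a) x * _ = 0
    rw [hx, zero_mul]
  · filter_upwards [h] with x hx
    change (0 : L2Box a) x * _ = 0
    rw [hx, zero_mul]

lemma HasWeakGradient.add {d : ℕ} {a : Fin d → ℝ} {u v : L2Box a} {G H : Fin d → L2Box a}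
    (hu : HasWeakGradient a u G) (hv : HasWeakGradient a v H) :
    HasWeakGradient a (u + v) (G + H) := by
  intro f hf hc hs i
  have key : ∀ (p q : L2Box a) (g : (Fin d → ℝ) → ℂ), Continuous g →
      ∫ x, (p + q) x * g x ∂(boxMeasure a) =
        ∫ x, p x * g x ∂(boxMeasure a) + ∫ x, q x * g x ∂(boxMeasure a) := by
    intro p q g hg
    rw [← integral_add (integrable_mul_continuous a p hg) (integrable_mul_continuous a q hg)]
    refine integral_congr_ae ?_
    filter_upwards [Lp.coeFn_add p q] with x hx
    rw [hx, Pi.add_apply, add_mul]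
  rw [key _ _ _ (contDiff_partialDeriv i hf).continuous, Pi.add_apply, key _ _ _ hf.continuous,
    hu f hf hc hs i, hv f hf hc hs i]
  ring

lemma HasWeakGradient.smul {d : ℕ} {a : Fin d → ℝ} {u : L2Box a} {G : Fin d → L2Box a}
    (c : ℂ) (hu : HasWeakGradient a u G) : HasWeakGradient a (c • u) (c • G) := by
  intro f hf hc hs i
  have key : ∀ (p : L2Box a) (g : (Fin d → ℝ) → ℂ),
      ∫ x, (c • p) x * g x ∂(boxMeasure a) = c * ∫ x, p x * g x ∂(boxMeasure a) := by
    intro p g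
    rw [← integral_const_mul]
    refine integral_congr_ae ?_
    filter_upwards [Lp.coeFn_smul c p] with x hx
    rw [hx, Pi.smul_apply, smul_eq_mul, mul_assoc]
  rw [key, Pi.smul_apply, key, hu f hf hc hs i]
  ring

/-- The triples `(f, ∇f, f|_{boundary})` for `f` smooth on `ℝ^d`. -/
def smoothTriples {d : ℕ} (a : Fin d → ℝ) :
    Submodule ℂ (L2Box a × (Fin d → L2Box a) × L2Bdry a) where
  carrier := {p | ∃ f : (Fin d → ℝ) → ℂ, ContDiff ℝ ∞ f ∧ p.1 =ᵐ[boxMeasure a] f ∧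
    (∀ i, p.2.1 i =ᵐ[boxMeasure a] partialDeriv i f) ∧ p.2.2 =ᵐ[surfaceMeasure a] f}
  zero_mem' := by
    refine ⟨0, contDiff_const, Lp.coeFn_zero _ _ _, fun i => ?_, Lp.coeFn_zero _ _ _⟩
    filter_upwards [Lp.coeFn_zero ℂ 2 (boxMeasure a)] with x hx
    change (0 : L2Box a) x = _
    rw [hx]
    have h0 : (0 : (Fin d → ℝ) → ℂ) = fun _ => 0 := rfl
    simp [partialDeriv, h0]
  add_mem' := by
    rintro p q ⟨f, hf, hf1, hf2, hf3⟩ ⟨g, hg, hg1, hg2, hg3⟩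
    refine ⟨f + g, hf.add hg, ?_, fun i => ?_, ?_⟩
    · exact (Lp.coeFn_add p.1 q.1).trans (hf1.add hg1)
    · refine (Lp.coeFn_add (p.2.1 i) (q.2.1 i)).trans (((hf2 i).add (hg2 i)).trans ?_)
      refine Eventually.of_forall fun x => ?_
      have h1 := (hf.differentiable (by simp)).differentiableAt (x := x)
      have h2 := (hg.differentiable (by simp)).differentiableAt (x := x)
      simp [partialDeriv, fderiv_add h1 h2]
    · exact (Lp.coeFn_add p.2.2 q.2.2).trans (hf3.add hg3)
  smul_mem' := by
    rintro c p ⟨f, hf, hf1, hf2, hf3⟩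
    refine ⟨c • f, contDiff_const.smul hf, ?_, fun i => ?_, ?_⟩
    · exact (Lp.coeFn_smul c p.1).trans (hf1.const_smul c)
    · refine (Lp.coeFn_smul c (p.2.1 i)).trans (((hf2 i).const_smul c).trans ?_)
      refine Eventually.of_forall fun x => ?_
      have h1 := (hf.differentiable (by simp)).differentiableAt (x := x)
      simp [partialDeriv, fderiv_const_smul h1]
    · exact (Lp.coeFn_smul c p.2.2).trans (hf3.const_smul c)

/-- `u ∈ H¹` of the hyperrectangle, with weak gradient `G` and boundary trace `g`. The trace operator
`H¹ → L²(boundary)` is the continuous extension of the restriction of functions that are smooth up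
to the boundary: there are smooth `f n` with `f n → u` and `∇ (f n) → G` in `L²` and with
`f n → g` in `L²` of the boundary. Every `u ∈ H¹` has exactly one such `G` and `g`. -/
def HasGradientAndTrace {d : ℕ} (a : Fin d → ℝ) (u : L2Box a) (G : Fin d → L2Box a)
    (g : L2Bdry a) : Prop :=
  HasWeakGradient a u G ∧ (u, G, g) ∈ (smoothTriples a).topologicalClosure

/-- The graph of the Robin Laplacian with parameter `α`, i.e. of the operator in `L²` that is
associated with the form `a_α[u, v] = ∫ ∇u · conj ∇v dx + α ∫ u conj v dσ` on `H¹`: the pairs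
`(u, h)` with `u ∈ H¹`, `h ∈ L²` and `a_α[u, v] = ∫ h conj v dx` for all `v ∈ H¹`. -/
def robinLaplacian {d : ℕ} (a : Fin d → ℝ) (α : ℂ) : Submodule ℂ (L2Box a × L2Box a) where
  carrier := {p | ∃ G g, HasGradientAndTrace a p.1 G g ∧
    ∀ v H k, HasGradientAndTrace a v H k →
      ∑ i, inner ℂ (H i) (G i) + α * inner ℂ k g = inner ℂ v p.2}
  zero_mem' := by
    refine ⟨0, 0, ⟨HasWeakGradient.zero a, Submodule.zero_mem _⟩, fun v H k _ => ?_⟩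
    simp
  add_mem' := by
    rintro p q ⟨G, g, hG, h⟩ ⟨G', g', hG', h'⟩
    refine ⟨G + G', g + g', ⟨hG.1.add hG'.1, Submodule.add_mem _ hG.2 hG'.2⟩, fun v H k hv => ?_⟩
    simp only [Pi.add_apply, inner_add_right, Finset.sum_add_distrib, Prod.snd_add,
      ← h v H k hv, ← h' v H k hv]
    ring
  smul_mem' := by
    rintro c p ⟨G, g, hG, h⟩
    refine ⟨c • G, c • g, ⟨hG.1.smul c, Submodule.smul_mem _ c hG.2⟩, fun v H k hv => ?_⟩
    simp only [Pi.smul_apply, inner_smul_right, Prod.smul_snd, ← h v H k hv, ← Finset.mul_sum]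
    ring

/-- `μ` is an eigenvalue of the Robin Laplacian with parameter `α`. -/
def IsRobinEigenvalue {d : ℕ} (a : Fin d → ℝ) (α μ : ℂ) : Prop :=
  ∃ u : L2Box a, u ≠ 0 ∧ (u, μ • u) ∈ robinLaplacian a α

/-- The kernel of the `n`-th power of `A - μ`, where `A` is the Robin Laplacian: `u` is in the
kernel of the power `n + 1` if `u` is in the domain of `A` and `A u - μ u` is in the kernel of the
power `n`. -/
def kerPow {d : ℕ} (a : Fin d → ℝ) (α μ : ℂ) : ℕ → Submodule ℂ (L2Box a)
  | 0 => ⊥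
  | n + 1 => Submodule.map (LinearMap.fst ℂ (L2Box a) (L2Box a))
      (robinLaplacian a α ⊓ Submodule.comap
        (LinearMap.snd ℂ (L2Box a) (L2Box a) - μ • LinearMap.fst ℂ (L2Box a) (L2Box a))
        (kerPow a α μ n))

/-- The algebraic multiplicity of `μ` as an eigenvalue of the Robin Laplacian: the dimension of the
space of all generalised eigenfunctions. -/
def algMultiplicity {d : ℕ} (a : Fin d → ℝ) (α μ : ℂ) : ℕ :=
  Module.finrank ℂ (⨆ n, kerPow a α μ n : Submodule ℂ (L2Box a))

/-- The open sector around the positive real axis with half-angle `φ`. -/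
def sectorPos (φ : ℝ) : Set ℂ := {z | z ≠ 0 ∧ |z.arg| < φ}

/-- The open sector around the negative real axis with half-angle `φ`. -/
def sectorNeg (φ : ℝ) : Set ℂ := {z | -z ∈ sectorPos φ}

/-- The filter of the limit `α → ∞` inside the sector around the negative real axis. -/
def sectorAtInfty (φ : ℝ) : Filter ℂ := cobounded ℂ ⊓ 𝓟 (sectorNeg φ)

/-- `lam` is an analytic curve of eigenvalues `lam α` of the Robin Laplacian with parameter `α`, for
all `α` in the sector around the negative real axis with `|α|` large enough. -/
def IsEigencurve {d : ℕ} (a : Fin d → ℝ) (φ : ℝ) (lam : ℂ → ℂ) : Prop :=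
  ∀ᶠ α in sectorAtInfty φ, IsRobinEigenvalue a α (lam α) ∧ AnalyticAt ℂ lam α

end RobinBox

end

/-! The operator separates. A product of shifted cosines whose frequencies `κ i` solve the Robin
problem on every interval is an eigenfunction with eigenvalue `∑ i, κ i ^ 2`. The operator is not
self-adjoint for non-real `α`; the modes with conjugate frequencies are eigenfunctions of its
adjoint, so they annihilate every generalised eigenfunction for a different eigenvalue
(`inner_eq_zero_of_mem_kerPow`).

No other eigenvalues exist because the modes are complete (`eq_zero_of_inner_modes`). For large `α`
in the sector the one-dimensional characteristic function has only simple zeros. If `u` is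
orthogonal to all adjoint modes, its cosine transform in one coordinate is entire, is `O(cosh (im
z))` and vanishes at these zeros. The characteristic function grows like `|z| cosh (im z)` on large
squares, so the quotient is entire and tends to zero there, hence vanishes. Freeing the coordinates
one by one shows that the Fourier transform of `u` is zero.

On an interval of half-length `l` each parity has exactly one large root up to sign, `κ = ± i k`
with `k = -α + O(1)` (`bigRoot`); all others have `|im κ| ≤ δ |α|` (`eventually_root_dichotomy`).
Moreover, for each `n` there is a root that stays bounded as `α → ∞`, converging to `(n + 1/2) π /
l` (`exists_analytic_bounded_root`).

For the first claim, `j` large frequencies are combined with `d - j` bounded ones; different `n`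
have different limits. For the second, an eigenvalue near `-d α ^ 2` needs a large frequency in
every coordinate (`close_of_sum_sq`), so only the `2 ^ d` choices of parities are left. Modes of
different parity are orthogonal, and together with completeness this gives the algebraic
multiplicities (`algMultiplicity_eq_card`). -/

noncomputable section

namespace RobinBox

/-! ### Product measures and integration by parts on the box -/

lemma boxMeasure_eq_pi {d : ℕ} (a : Fin d → ℝ) :
    boxMeasure a = Measure.pi fun i => (volume : Measure ℝ).restrict (Set.Ioo (-a i) (a i)) := by
  rw [boxMeasure, box, volume_pi, Measure.restrict_pi_pi]

/-- The box measure with the factor in the coordinate `j` replaced by `ν`. -/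
def slabMeasure {d : ℕ} (a : Fin d → ℝ) (j : Fin d) (ν : Measure ℝ) : Measure (Fin d → ℝ) :=
  Measure.pi (Function.update
    (fun i => (volume : Measure ℝ).restrict (Set.Ioo (-a i) (a i))) j ν)

lemma boxMeasure_eq_slabMeasure {d : ℕ} (a : Fin d → ℝ) (j : Fin d) :
    boxMeasure a = slabMeasure a j (volume.restrict (Set.Ioo (-a j) (a j))) := by
  rw [slabMeasure, boxMeasure_eq_pi, Function.update_eq_self]

lemma faceMeasure_eq_slabMeasure {d : ℕ} (a : Fin d → ℝ) (j : Fin d) (c : ℝ) :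
    faceMeasure a j c = slabMeasure a j (Measure.dirac c) := rfl

instance isFiniteMeasure_update {d : ℕ} (a : Fin d → ℝ) (j : Fin d) (ν : Measure ℝ)
    [IsFiniteMeasure ν] (i : Fin d) : IsFiniteMeasure (Function.update
    (fun i => (volume : Measure ℝ).restrict (Set.Ioo (-a i) (a i))) j ν i) := by
  rcases eq_or_ne i j with rfl | h
  · rw [Function.update_self]; infer_instance
  · rw [Function.update_of_ne h]; infer_instance

instance isFiniteMeasure_slabMeasure {d : ℕ} (a : Fin d → ℝ) (j : Fin d) (ν : Measure ℝ)
    [IsFiniteMeasure ν] : IsFiniteMeasure (slabMeasure a j ν) := by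
  unfold slabMeasure; infer_instance

instance isFiniteMeasure_faceMeasure {d : ℕ} (a : Fin d → ℝ) (j : Fin d) (c : ℝ) :
    IsFiniteMeasure (faceMeasure a j c) := isFiniteMeasure_slabMeasure a j _

instance isFiniteMeasure_surfaceMeasure {d : ℕ} (a : Fin d → ℝ) :
    IsFiniteMeasure (surfaceMeasure a) := by
  unfold surfaceMeasure; infer_instance

lemma ae_slabMeasure_mem_Icc {d : ℕ} (a : Fin d → ℝ) (j : Fin d) (ν : Measure ℝ)
    [IsFiniteMeasure ν] (hν : ∀ᵐ t ∂ν, t ∈ Set.Icc (-a j) (a j)) :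
    ∀ᵐ x ∂(slabMeasure a j ν), x ∈ Set.Icc (-a) a := by
  have h : ∀ i, ∀ᵐ x ∂(slabMeasure a j ν), x i ∈ Set.Icc (-a i) (a i) := by
    intro i
    refine Measure.tendsto_eval_ae_ae.eventually (p := fun t => t ∈ Set.Icc (-a i) (a i)) ?_
    rcases eq_or_ne i j with rfl | hij
    · rwa [Function.update_self]
    · rw [Function.update_of_ne hij]
      exact (ae_restrict_iff' measurableSet_Ioo).2
        (Eventually.of_forall fun t ht => Set.Ioo_subset_Icc_self ht)
  filter_upwards [ae_all_iff.2 h] with x hx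
  exact ⟨fun i => (hx i).1, fun i => (hx i).2⟩

lemma ae_boxMeasure_mem_Icc {d : ℕ} (a : Fin d → ℝ) :
    ∀ᵐ x ∂(boxMeasure a), x ∈ Set.Icc (-a) a :=
  (ae_restrict_iff' (MeasurableSet.univ_pi fun _ => measurableSet_Ioo)).2
    (Eventually.of_forall fun _ hx => box_subset a hx)

lemma ae_faceMeasure_mem_Icc {d : ℕ} {a : Fin d → ℝ} (j : Fin d) {c : ℝ}
    (hc : c ∈ Set.Icc (-a j) (a j)) : ∀ᵐ x ∂(faceMeasure a j c), x ∈ Set.Icc (-a) a :=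
  ae_slabMeasure_mem_Icc a j _ ((ae_dirac_iff measurableSet_Icc).2 hc)

lemma ae_surfaceMeasure_mem_Icc {d : ℕ} {a : Fin d → ℝ} (ha : ∀ i, 0 < a i) :
    ∀ᵐ x ∂(surfaceMeasure a), x ∈ Set.Icc (-a) a := by
  rw [surfaceMeasure, ← Measure.sum_fintype, Measure.ae_sum_iff]
  intro j
  rw [ae_add_measure_iff]
  have := ha j
  exact ⟨ae_faceMeasure_mem_Icc j ⟨le_rfl, by linarith⟩,
    ae_faceMeasure_mem_Icc j ⟨by linarith, le_rfl⟩⟩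

lemma memLp_of_ae_mem_Icc {d : ℕ} {a : Fin d → ℝ} {μ : Measure (Fin d → ℝ)} [IsFiniteMeasure μ]
    (hμ : ∀ᵐ x ∂μ, x ∈ Set.Icc (-a) a) {f : (Fin d → ℝ) → ℂ} (hf : Continuous f)
    (p : ENNReal) : MemLp f p μ := by
  obtain ⟨C, hC⟩ := (isCompact_Icc (a := -a) (b := a)).exists_bound_of_continuousOn hf.continuousOn
  exact MemLp.of_bound hf.aestronglyMeasurable C (hμ.mono hC)

lemma integrable_of_ae_mem_Icc {d : ℕ} {a : Fin d → ℝ} {μ : Measure (Fin d → ℝ)}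
    [IsFiniteMeasure μ] (hμ : ∀ᵐ x ∂μ, x ∈ Set.Icc (-a) a) {f : (Fin d → ℝ) → ℂ}
    (hf : Continuous f) : Integrable f μ :=
  memLp_one_iff_integrable.1 (memLp_of_ae_mem_Icc hμ hf 1)

/-- The measure of the coordinates other than `j`. -/
def crossMeasure {n : ℕ} (a : Fin (n + 1) → ℝ) (j : Fin (n + 1)) : Measure (Fin n → ℝ) :=
  Measure.pi fun i => volume.restrict (Set.Ioo (-a (j.succAbove i)) (a (j.succAbove i)))

instance isFiniteMeasure_crossMeasure {n : ℕ} (a : Fin (n + 1) → ℝ) (j : Fin (n + 1)) :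
    IsFiniteMeasure (crossMeasure a j) := by
  unfold crossMeasure; infer_instance

lemma measurePreserving_slabMeasure {n : ℕ} (a : Fin (n + 1) → ℝ) (j : Fin (n + 1))
    (ν : Measure ℝ) [IsFiniteMeasure ν] :
    MeasurePreserving (MeasurableEquiv.piFinSuccAbove (fun _ => ℝ) j).symm
      (ν.prod (crossMeasure a j)) (slabMeasure a j ν) := by
  have h := (measurePreserving_piFinSuccAbove (Function.update
    (fun i => (volume : Measure ℝ).restrict (Set.Ioo (-a i) (a i))) j ν) j).symm
  simpa only [Function.update_self, Function.update_of_ne (Fin.succAbove_ne j _), crossMeasure,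
    slabMeasure] using h

/-- With Lebesgue measure or a Dirac mass for `ν`, integrals over the box and over two opposite
faces become integrals over the same cross section. Green's formula in the coordinate `j` is then an
identity on each line. -/
lemma integral_slabMeasure {n : ℕ} (a : Fin (n + 1) → ℝ) (j : Fin (n + 1))
    (ν : Measure ℝ) [IsFiniteMeasure ν] {F : (Fin (n + 1) → ℝ) → ℂ}
    (hF : Integrable F (slabMeasure a j ν)) :
    ∫ x, F x ∂(slabMeasure a j ν) = ∫ y, ∫ t, F (j.insertNth t y) ∂ν ∂(crossMeasure a j) := by
  have hp := measurePreserving_slabMeasure a j ν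
  rw [← hp.integral_comp' F, integral_prod_symm]
  · rfl
  · exact (hp.integrable_comp_emb (MeasurableEquiv.measurableEmbedding _)).2 hF

lemma integrable_integral_slabMeasure {n : ℕ} (a : Fin (n + 1) → ℝ) (j : Fin (n + 1))
    (ν : Measure ℝ) [IsFiniteMeasure ν] {F : (Fin (n + 1) → ℝ) → ℂ}
    (hF : Integrable F (slabMeasure a j ν)) :
    Integrable (fun y => ∫ t, F (j.insertNth t y) ∂ν) (crossMeasure a j) := by
  have hp := measurePreserving_slabMeasure a j ν
  have h := (hp.integrable_comp_emb (MeasurableEquiv.measurableEmbedding _)).2 hF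
  exact h.integral_prod_right

lemma hasDerivAt_insertNth {n : ℕ} (j : Fin (n + 1)) (y : Fin n → ℝ) (t : ℝ) :
    HasDerivAt (fun s => (j.insertNth s y : Fin (n + 1) → ℝ)) (Pi.single j 1) t := by
  have h := hasDerivAt_update (j.insertNth 0 y : Fin (n + 1) → ℝ) j t
  have e : Function.update (j.insertNth 0 y : Fin (n + 1) → ℝ) j =
      fun s : ℝ => (j.insertNth s y : Fin (n + 1) → ℝ) :=
    funext fun s => Fin.update_insertNth (α := fun _ => ℝ) j 0 s y
  rwa [e] at h

lemma hasDerivAt_comp_insertNth {n : ℕ} {f : (Fin (n + 1) → ℝ) → ℂ} (hf : Differentiable ℝ f)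
    (j : Fin (n + 1)) (y : Fin n → ℝ) (t : ℝ) :
    HasDerivAt (fun s => f (j.insertNth s y)) (partialDeriv j f (j.insertNth t y)) t :=
  (hf _).hasFDerivAt.comp_hasDerivAt t (hasDerivAt_insertNth j y t)

/-! ### Separated modes -/

/-- The phase of the even (`false`) and of the odd (`true`) modes. -/
def phase (b : Bool) : ℂ := if b then ((Real.pi / 2 : ℝ) : ℂ) else 0

/-- The characteristic function of the Robin problem on an interval. -/
def charFn (b : Bool) (A z : ℂ) : ℂ :=
  z * Complex.sin (z - phase b) - A * Complex.cos (z - phase b)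

/-- The product `∏ i, cos (κ i * x i - phase (b i))`. -/
def modeProd {d : ℕ} (κ : Fin d → ℂ) (b : Fin d → Bool) (x : Fin d → ℝ) : ℂ :=
  ∏ i, Complex.cos (κ i * x i - phase (b i))

lemma contDiff_modeProd {d : ℕ} (κ : Fin d → ℂ) (b : Fin d → Bool) :
    ContDiff ℝ ∞ (modeProd κ b) := by
  unfold modeProd
  refine contDiff_prod fun i _ => ?_
  have h : ContDiff ℝ ∞ (fun x : Fin d → ℝ => κ i * (x i : ℂ) - phase (b i)) :=
    (contDiff_const.mul (Complex.ofRealCLM.contDiff.comp (contDiff_apply ℝ ℝ i))).sub contDiff_const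
  exact (Complex.contDiff_cos.restrict_scalars ℝ).comp h

lemma conj_phase (b : Bool) : (starRingEnd ℂ) (phase b) = phase b := by
  cases b
  · simp [phase]
  · simp only [phase, if_true, Complex.conj_ofReal]

lemma conj_modeProd {d : ℕ} (κ : Fin d → ℂ) (b : Fin d → Bool) (x : Fin d → ℝ) :
    (starRingEnd ℂ) (modeProd κ b x) = modeProd (fun i => (starRingEnd ℂ) (κ i)) b x := by
  simp [modeProd, map_prod, ← Complex.cos_conj, conj_phase]

lemma conj_charFn (b : Bool) (A z : ℂ) : (starRingEnd ℂ) (charFn b A z) =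
    charFn b ((starRingEnd ℂ) A) ((starRingEnd ℂ) z) := by
  simp [charFn, ← Complex.cos_conj, ← Complex.sin_conj, conj_phase]

/-- `κ` solves the characteristic equations of all the coordinates. -/
def IsRoot {d : ℕ} (a : Fin d → ℝ) (α : ℂ) (κ : Fin d → ℂ) (b : Fin d → Bool) : Prop :=
  ∀ i, charFn (b i) (α * a i) (κ i * a i) = 0

lemma IsRoot.conj {d : ℕ} {a : Fin d → ℝ} {α : ℂ} {κ : Fin d → ℂ} {b : Fin d → Bool}
    (h : IsRoot a α κ b) :
    IsRoot a ((starRingEnd ℂ) α) (fun i => (starRingEnd ℂ) (κ i)) b := by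
  intro i
  have := congrArg (starRingEnd ℂ) (h i)
  rw [conj_charFn] at this
  simpa using this

lemma modeProd_insertNth {n : ℕ} (κ : Fin (n + 1) → ℂ) (b : Fin (n + 1) → Bool)
    (j : Fin (n + 1)) (t : ℝ) (y : Fin n → ℝ) :
    modeProd κ b (j.insertNth t y) = Complex.cos (κ j * t - phase (b j)) *
      modeProd (fun i => κ (j.succAbove i)) (fun i => b (j.succAbove i)) y := by
  simp [modeProd, Fin.prod_univ_succAbove _ j]

lemma hasDerivAt_cos_mode (k p : ℂ) (t : ℝ) :
    HasDerivAt (fun s : ℝ => Complex.cos (k * s - p)) (-(k * Complex.sin (k * t - p))) t := by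
  have h : HasDerivAt (fun z : ℂ => Complex.cos (k * z - p))
      (-Complex.sin (k * (t : ℂ) - p) * (k * 1)) (t : ℂ) :=
    (((hasDerivAt_id (t : ℂ)).const_mul k).sub_const p).ccos
  convert h.comp_ofReal using 1
  ring

lemma hasDerivAt_sin_mode (k p : ℂ) (t : ℝ) :
    HasDerivAt (fun s : ℝ => -(k * Complex.sin (k * s - p)))
      (-(k ^ 2 * Complex.cos (k * t - p))) t := by
  have h : HasDerivAt (fun z : ℂ => -(k * Complex.sin (k * z - p)))
      (-(k * (Complex.cos (k * (t : ℂ) - p) * (k * 1)))) (t : ℂ) :=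
    ((((hasDerivAt_id (t : ℂ)).const_mul k).sub_const p).csin.const_mul k).neg
  convert h.comp_ofReal using 1
  ring

/-- The Robin condition at the two end points. -/
lemma robin_endpoint {b : Bool} {α k : ℂ} {l : ℝ} (hl : 0 < l)
    (h : charFn b (α * l) (k * l) = 0) :
    k * Complex.sin (k * l - phase b) = α * Complex.cos (k * l - phase b) ∧
      k * Complex.sin (k * (-l : ℝ) - phase b) = -(α * Complex.cos (k * (-l : ℝ) - phase b)) := by
  have hl' : (l : ℂ) ≠ 0 := by exact_mod_cast hl.ne'
  have h1 : k * Complex.sin (k * l - phase b) = α * Complex.cos (k * l - phase b) := by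
    apply mul_right_cancel₀ hl'
    unfold charFn at h
    linear_combination h
  refine ⟨h1, ?_⟩
  have e : k * ((-l : ℝ) : ℂ) - phase b = -(k * l + phase b) := by push_cast; ring
  rw [e, Complex.sin_neg, Complex.cos_neg]
  cases b
  · simp only [phase, Bool.false_eq_true, if_false, sub_zero, add_zero] at h1 ⊢
    linear_combination -h1
  · simp only [phase, if_true] at h1 ⊢
    push_cast at h1 ⊢
    rw [Complex.sin_sub_pi_div_two, Complex.cos_sub_pi_div_two] at h1
    rw [Complex.sin_add_pi_div_two, Complex.cos_add_pi_div_two]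
    linear_combination h1

lemma partialDeriv_modeProd_insertNth {n : ℕ} (κ : Fin (n + 1) → ℂ) (b : Fin (n + 1) → Bool)
    (j : Fin (n + 1)) (t : ℝ) (y : Fin n → ℝ) :
    partialDeriv j (modeProd κ b) (j.insertNth t y) =
      -(κ j * Complex.sin (κ j * t - phase (b j))) *
      modeProd (fun i => κ (j.succAbove i)) (fun i => b (j.succAbove i)) y := by
  have h := hasDerivAt_comp_insertNth ((contDiff_modeProd κ b).differentiable (by simp)) j y t
  refine h.unique ?_
  simp only [modeProd_insertNth]
  exact (hasDerivAt_cos_mode _ _ _).mul_const _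

/-- The Robin conditions at the two ends turn the boundary terms of the integration by parts, which
contain the sine, into boundary values of the mode itself. -/
lemma integral_Ioo_modes {b : Bool} {α k : ℂ} {l : ℝ} (hl : 0 < l)
    (h : charFn b (α * l) (k * l) = 0) {g g' : ℝ → ℂ} (hg : ∀ t, HasDerivAt g (g' t) t)
    (hg' : Continuous g') :
    ∫ t in Set.Ioo (-l) l, -(k * Complex.sin (k * t - phase b)) * g' t =
      k ^ 2 * (∫ t in Set.Ioo (-l) l, Complex.cos (k * t - phase b) * g t)
      - α * (Complex.cos (k * l - phase b) * g l
        + Complex.cos (k * (-l : ℝ) - phase b) * g (-l)) := by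
  have hle : -l ≤ l := by linarith
  rw [← integral_Ioc_eq_integral_Ioo, ← integral_Ioc_eq_integral_Ioo,
    ← intervalIntegral.integral_of_le hle, ← intervalIntegral.integral_of_le hle]
  rw [intervalIntegral.integral_mul_deriv_eq_deriv_mul (fun t _ => hasDerivAt_sin_mode k (phase b) t)
    (fun t _ => hg t) (Continuous.intervalIntegrable (by fun_prop) _ _)
    (hg'.intervalIntegrable _ _)]
  obtain ⟨h1, h2⟩ := robin_endpoint hl h
  have h3 : ∫ t in -l..l, -(k ^ 2 * Complex.cos (k * t - phase b)) * g t =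
      -(k ^ 2 * ∫ t in -l..l, Complex.cos (k * t - phase b) * g t) := by
    rw [← intervalIntegral.integral_const_mul, ← intervalIntegral.integral_neg]
    exact intervalIntegral.integral_congr fun t _ => by ring
  rw [h3, h1, h2]
  ring

lemma continuous_partialDeriv {d : ℕ} (i : Fin d) {f : (Fin d → ℝ) → ℂ} (hf : ContDiff ℝ ∞ f) :
    Continuous (partialDeriv i f) := (contDiff_partialDeriv i hf).continuous

/-- Integration by parts in one coordinate, for a mode against a smooth function. -/
lemma green_coordinate {d : ℕ} {a : Fin d → ℝ} (ha : ∀ i, 0 < a i) {α : ℂ} {κ : Fin d → ℂ}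
    {b : Fin d → Bool} (h : IsRoot a α κ b) {f : (Fin d → ℝ) → ℂ} (hf : ContDiff ℝ ∞ f)
    (j : Fin d) :
    ∫ x, partialDeriv j (modeProd κ b) x * partialDeriv j f x ∂(boxMeasure a) =
      κ j ^ 2 * ∫ x, modeProd κ b x * f x ∂(boxMeasure a) -
      α * (∫ x, modeProd κ b x * f x ∂(faceMeasure a j (a j)) +
        ∫ x, modeProd κ b x * f x ∂(faceMeasure a j (-a j))) := by
  obtain _ | n := d
  · exact j.elim0
  have hw := contDiff_modeProd κ b
  have hc : Continuous fun x => modeProd κ b x * f x := hw.continuous.mul hf.continuous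
  have haj := ha j
  have i1 := integrable_of_ae_mem_Icc (ae_boxMeasure_mem_Icc a)
    (f := fun x => partialDeriv j (modeProd κ b) x * partialDeriv j f x)
    ((continuous_partialDeriv j hw).mul (continuous_partialDeriv j hf))
  have i2 := integrable_of_ae_mem_Icc (ae_boxMeasure_mem_Icc a) hc
  have i3 := integrable_of_ae_mem_Icc
    (ae_faceMeasure_mem_Icc (a := a) j (c := a j) ⟨by linarith, le_rfl⟩) hc
  have i4 := integrable_of_ae_mem_Icc
    (ae_faceMeasure_mem_Icc (a := a) j (c := -a j) ⟨le_rfl, by linarith⟩) hc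
  rw [boxMeasure_eq_slabMeasure a j] at i1 i2 ⊢
  rw [faceMeasure_eq_slabMeasure] at i3 i4 ⊢
  rw [faceMeasure_eq_slabMeasure]
  have j2 := integrable_integral_slabMeasure a j _ i2
  have j3 := integrable_integral_slabMeasure a j _ i3
  have j4 := integrable_integral_slabMeasure a j _ i4
  have j5 := (j3.add j4).const_mul α
  simp only [Pi.add_apply] at j5
  rw [integral_slabMeasure a j _ i1, integral_slabMeasure a j _ i2, integral_slabMeasure a j _ i3,
    integral_slabMeasure a j _ i4, ← integral_add j3 j4, ← integral_const_mul,
    ← integral_const_mul, ← integral_sub (j2.const_mul _) j5]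
  refine integral_congr_ae (Eventually.of_forall fun y => ?_)
  simp only [integral_dirac, modeProd_insertNth, partialDeriv_modeProd_insertNth]
  have hg := hasDerivAt_comp_insertNth (hf.differentiable (by simp)) j y
  have hins : Continuous fun t : ℝ => (j.insertNth t y : Fin (n + 1) → ℝ) :=
    continuous_iff_continuousAt.2 fun t => (hasDerivAt_insertNth j y t).continuousAt
  have key := integral_Ioo_modes haj (h j) hg ((continuous_partialDeriv j hf).comp hins)
  set c := modeProd (fun i => κ (j.succAbove i)) (fun i => b (j.succAbove i)) y
  have e1 : ∀ g : ℝ → ℂ, ∀ F : ℝ → ℂ, ∫ t in Set.Ioo (-a j) (a j), F t * c * g t =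
      c * ∫ t in Set.Ioo (-a j) (a j), F t * g t := fun g F => by
    rw [← integral_const_mul]
    exact integral_congr_ae (Eventually.of_forall fun t => by ring)
  rw [e1, e1, key]
  ring

/-! ### Modes as eigenfunctions -/

/-- A continuous function as an element of `L²` of the box. -/
def boxLp {d : ℕ} (a : Fin d → ℝ) {f : (Fin d → ℝ) → ℂ} (hf : Continuous f) : L2Box a :=
  (memLp_of_ae_mem_Icc (ae_boxMeasure_mem_Icc a) hf 2).toLp f

/-- The mode `modeProd κ b` as an element of `L²` of the box. -/
def modeLp {d : ℕ} (a : Fin d → ℝ) (κ : Fin d → ℂ) (b : Fin d → Bool) : L2Box a :=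
  boxLp a (contDiff_modeProd κ b).continuous

lemma coeFn_boxLp {d : ℕ} (a : Fin d → ℝ) {f : (Fin d → ℝ) → ℂ} (hf : Continuous f) :
    boxLp a hf =ᵐ[boxMeasure a] f := MemLp.coeFn_toLp _

/-- Test functions are supported in the box, so both integrals extend to the whole space, where
integration by parts has no boundary terms. -/
lemma hasWeakGradient_of_contDiff {d : ℕ} {a : Fin d → ℝ} {f : (Fin d → ℝ) → ℂ}
    (hf : ContDiff ℝ ∞ f) {u : L2Box a} {G : Fin d → L2Box a} (hu : u =ᵐ[boxMeasure a] f)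
    (hG : ∀ i, G i =ᵐ[boxMeasure a] partialDeriv i f) : HasWeakGradient a u G := by
  intro g hg hgc hgs i
  have hdg : ∀ x ∉ box a, partialDeriv i g x = 0 := fun x hx => by
    have : fderiv ℝ g x = 0 := image_eq_zero_of_notMem_tsupport
      (fun h => hx (hgs (tsupport_fderiv_subset ℝ h)))
    simp [partialDeriv, this]
  have hg0 : ∀ x ∉ box a, g x = 0 := fun x hx =>
    image_eq_zero_of_notMem_tsupport fun h => hx (hgs h)
  have hcg : HasCompactSupport (partialDeriv i g) := by
    have := hgc.fderiv_apply ℝ (Pi.single i (1 : ℝ))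
    exact this
  have e1 : ∫ x, u x * partialDeriv i g x ∂(boxMeasure a) = ∫ x, f x * partialDeriv i g x := by
    refine (integral_congr_ae (hu.mono fun x hx => ?_)).trans
      (setIntegral_eq_integral_of_forall_compl_eq_zero (s := box a)
      (fun x hx => by rw [hdg x hx, mul_zero]))
    simp only [hx]
  have e2 : ∫ x, G i x * g x ∂(boxMeasure a) = ∫ x, partialDeriv i f x * g x := by
    refine (integral_congr_ae ((hG i).mono fun x hx => ?_)).trans
      (setIntegral_eq_integral_of_forall_compl_eq_zero (s := box a)
      (fun x hx => by rw [hg0 x hx, mul_zero]))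
    simp only [hx]
  rw [e1, e2]
  have cf := continuous_partialDeriv i hf
  have cg := continuous_partialDeriv i hg
  refine integral_mul_fderiv_eq_neg_fderiv_mul_of_integrable (v := (Pi.single i 1 : Fin d → ℝ)) ?_ ?_ ?_ ?_ ?_
  · exact (cf.mul hg.continuous).integrable_of_hasCompactSupport hgc.mul_left
  · exact (hf.continuous.mul cg).integrable_of_hasCompactSupport hcg.mul_left
  · exact (hf.continuous.mul hg.continuous).integrable_of_hasCompactSupport hgc.mul_left
  · exact fun x _ => hf.differentiable (by simp) x
  · exact fun x _ => hg.differentiable (by simp) x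

/-- The gradient of a mode. -/
def modeGrad {d : ℕ} (a : Fin d → ℝ) (κ : Fin d → ℂ) (b : Fin d → Bool) (i : Fin d) : L2Box a :=
  boxLp a (continuous_partialDeriv i (contDiff_modeProd κ b))

/-- The boundary values of a mode. -/
def modeTrace {d : ℕ} {a : Fin d → ℝ} (ha : ∀ i, 0 < a i) (κ : Fin d → ℂ) (b : Fin d → Bool) :
    L2Bdry a :=
  (memLp_of_ae_mem_Icc (ae_surfaceMeasure_mem_Icc ha)
    (contDiff_modeProd κ b).continuous 2).toLp (modeProd κ b)

lemma coeFn_modeLp {d : ℕ} (a : Fin d → ℝ) (κ : Fin d → ℂ) (b : Fin d → Bool) :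
    modeLp a κ b =ᵐ[boxMeasure a] modeProd κ b := coeFn_boxLp a _

lemma coeFn_modeGrad {d : ℕ} (a : Fin d → ℝ) (κ : Fin d → ℂ) (b : Fin d → Bool) (i : Fin d) :
    modeGrad a κ b i =ᵐ[boxMeasure a] partialDeriv i (modeProd κ b) := coeFn_boxLp a _

lemma coeFn_modeTrace {d : ℕ} {a : Fin d → ℝ} (ha : ∀ i, 0 < a i) (κ : Fin d → ℂ)
    (b : Fin d → Bool) : modeTrace ha κ b =ᵐ[surfaceMeasure a] modeProd κ b :=
  MemLp.coeFn_toLp _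

lemma hasGradientAndTrace_modeLp {d : ℕ} {a : Fin d → ℝ} (ha : ∀ i, 0 < a i) (κ : Fin d → ℂ)
    (b : Fin d → Bool) :
    HasGradientAndTrace a (modeLp a κ b) (modeGrad a κ b) (modeTrace ha κ b) :=
  ⟨hasWeakGradient_of_contDiff (contDiff_modeProd κ b) (coeFn_modeLp a κ b) (coeFn_modeGrad a κ b),
    subset_closure ⟨modeProd κ b, contDiff_modeProd κ b, coeFn_modeLp a κ b,
      coeFn_modeGrad a κ b, coeFn_modeTrace ha κ b⟩⟩

lemma integral_surfaceMeasure {d : ℕ} {a : Fin d → ℝ} (ha : ∀ i, 0 < a i)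
    {f : (Fin d → ℝ) → ℂ} (hf : Continuous f) :
    ∫ x, f x ∂(surfaceMeasure a) =
      ∑ j, (∫ x, f x ∂(faceMeasure a j (a j)) + ∫ x, f x ∂(faceMeasure a j (-a j))) := by
  have h1 : ∀ j, Integrable f (faceMeasure a j (a j)) := fun j =>
    integrable_of_ae_mem_Icc (ae_faceMeasure_mem_Icc j ⟨by linarith [ha j], le_rfl⟩) hf
  have h2 : ∀ j, Integrable f (faceMeasure a j (-a j)) := fun j =>
    integrable_of_ae_mem_Icc (ae_faceMeasure_mem_Icc j ⟨le_rfl, by linarith [ha j]⟩) hf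
  rw [surfaceMeasure, integral_finsetSum_measure fun j _ => (h2 j).add_measure (h1 j)]
  refine Finset.sum_congr rfl fun j _ => ?_
  rw [integral_add_measure (h2 j) (h1 j), add_comm]

/-- The pairing is bilinear here, so `α` and `κ` occur without conjugates; those enter only with the
inner product. -/
lemma green_smooth {d : ℕ} {a : Fin d → ℝ} (ha : ∀ i, 0 < a i) {α : ℂ} {κ : Fin d → ℂ}
    {b : Fin d → Bool} (h : IsRoot a α κ b) {f : (Fin d → ℝ) → ℂ} (hf : ContDiff ℝ ∞ f) :
    ∑ j, ∫ x, partialDeriv j (modeProd κ b) x * partialDeriv j f x ∂(boxMeasure a) +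
      α * ∫ x, modeProd κ b x * f x ∂(surfaceMeasure a) =
      (∑ j, κ j ^ 2) * ∫ x, modeProd κ b x * f x ∂(boxMeasure a) := by
  rw [integral_surfaceMeasure ha (f := fun x => modeProd κ b x * f x)
      ((contDiff_modeProd κ b).continuous.mul hf.continuous),
    Finset.sum_congr rfl fun j _ => green_coordinate ha h hf j, Finset.sum_sub_distrib,
    Finset.sum_mul, Finset.mul_sum]
  ring

lemma inner_eq_integral {X : Type*} [MeasurableSpace X] {μ : Measure X} {u v : Lp ℂ 2 μ}
    {f g : X → ℂ} (hu : u =ᵐ[μ] f) (hv : v =ᵐ[μ] g) :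
    inner ℂ u v = ∫ x, (starRingEnd ℂ) (f x) * g x ∂μ := by
  rw [L2.inner_def]
  refine integral_congr_ae ?_
  filter_upwards [hu, hv] with x h1 h2
  rw [h1, h2, RCLike.inner_apply, mul_comm]

lemma conj_partialDeriv_modeProd {d : ℕ} (κ : Fin d → ℂ) (b : Fin d → Bool) (i : Fin d)
    (x : Fin d → ℝ) : (starRingEnd ℂ) (partialDeriv i (modeProd κ b) x) =
      partialDeriv i (modeProd (fun i => (starRingEnd ℂ) (κ i)) b) x := by
  have h := ((contDiff_modeProd κ b).differentiable (by simp)) x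
  have e : modeProd (fun i => (starRingEnd ℂ) (κ i)) b =
      fun y => Complex.conjCLE (modeProd κ b y) := by
    funext y; rw [← conj_modeProd]; rfl
  rw [partialDeriv, partialDeriv, e]
  have := (Complex.conjCLE.toContinuousLinearMap.hasFDerivAt.comp x h.hasFDerivAt).fderiv
  rw [show (fun y => Complex.conjCLE (modeProd κ b y)) =
    (Complex.conjCLE.toContinuousLinearMap ∘ modeProd κ b) from rfl, this]
  rfl

/-- Green's formula for a mode of the adjoint problem and a function in `H¹`. -/
lemma green_form {d : ℕ} {a : Fin d → ℝ} (ha : ∀ i, 0 < a i) {α : ℂ} {κ : Fin d → ℂ}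
    {b : Fin d → Bool} (h : IsRoot a α κ b) {u : L2Box a} {G : Fin d → L2Box a} {g : L2Bdry a}
    (hu : HasGradientAndTrace a u G g) :
    ∑ i, inner ℂ (modeGrad a (fun i => (starRingEnd ℂ) (κ i)) b i) (G i) +
      α * inner ℂ (modeTrace ha (fun i => (starRingEnd ℂ) (κ i)) b) g =
      (∑ i, κ i ^ 2) * inner ℂ (modeLp a (fun i => (starRingEnd ℂ) (κ i)) b) u := by
  set κ' := fun i => (starRingEnd ℂ) (κ i)
  have hκ : (fun i => (starRingEnd ℂ) (κ' i)) = κ := funext fun i => Complex.conj_conj _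
  -- Both sides are continuous in the function, its gradient and its trace, and such triples are
  -- limits of smooth ones. So the smooth case suffices.
  have hcl : IsClosed {p : L2Box a × (Fin d → L2Box a) × L2Bdry a |
      ∑ i, inner ℂ (modeGrad a κ' b i) (p.2.1 i) + α * inner ℂ (modeTrace ha κ' b) p.2.2 =
      (∑ i, κ i ^ 2) * inner ℂ (modeLp a κ' b) p.1} := by
    refine isClosed_eq ?_ ?_
    · refine Continuous.add (continuous_finsetSum _ fun i _ => ?_) ?_
      · exact continuous_const.inner ((continuous_apply i).comp (continuous_fst.comp continuous_snd))
      · exact continuous_const.mul (continuous_const.inner (continuous_snd.comp continuous_snd))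
    · exact continuous_const.mul (continuous_const.inner continuous_fst)
  refine hcl.closure_subset_iff.2 ?_ hu.2
  rintro p ⟨f, hf, h1, h2, h3⟩
  have key := green_smooth ha h hf
  change _ = _
  rw [inner_eq_integral (coeFn_modeLp a κ' b) h1, inner_eq_integral (coeFn_modeTrace ha κ' b) h3,
    Finset.sum_congr rfl fun i _ => inner_eq_integral (coeFn_modeGrad a κ' b i) (h2 i)]
  simpa only [conj_modeProd, conj_partialDeriv_modeProd, hκ] using key

lemma inner_of_mem_robinLaplacian {d : ℕ} {a : Fin d → ℝ} (ha : ∀ i, 0 < a i) {α : ℂ}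
    {κ : Fin d → ℂ} {b : Fin d → Bool} (h : IsRoot a α κ b) {u f : L2Box a}
    (hu : (u, f) ∈ robinLaplacian a α) :
    inner ℂ (modeLp a (fun i => (starRingEnd ℂ) (κ i)) b) f =
      (∑ i, κ i ^ 2) * inner ℂ (modeLp a (fun i => (starRingEnd ℂ) (κ i)) b) u := by
  obtain ⟨G, g, hG, hv⟩ := hu
  rw [← green_form ha h hG]
  exact (hv _ _ _ (hasGradientAndTrace_modeLp ha _ b)).symm

lemma modeLp_mem_robinLaplacian {d : ℕ} {a : Fin d → ℝ} (ha : ∀ i, 0 < a i) {α : ℂ}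
    {κ : Fin d → ℂ} {b : Fin d → Bool} (h : IsRoot a α κ b) :
    (modeLp a κ b, (∑ i, κ i ^ 2) • modeLp a κ b) ∈ robinLaplacian a α := by
  refine ⟨_, _, hasGradientAndTrace_modeLp ha κ b, fun v H k hv => ?_⟩
  -- The test function occupies the conjugated slot of the form, so Green's formula is taken for the
  -- conjugate parameter and roots and then conjugated.
  have key := congrArg (starRingEnd ℂ) (green_form ha h.conj hv)
  simp only [map_add, map_sum, map_mul, map_pow, Complex.conj_conj, inner_conj_symm] at key
  rw [inner_smul_right, ← key]

/-- Against an eigenfunction of the adjoint, applying `A - μ` multiplies the pairing by `∑ i, κ i ^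
2 - μ`, which is not zero. So the pairing vanishes as soon as it does after one more application. -/
lemma inner_eq_zero_of_mem_kerPow {d : ℕ} {a : Fin d → ℝ} (ha : ∀ i, 0 < a i) {α μ : ℂ}
    {κ : Fin d → ℂ} {b : Fin d → Bool} (h : IsRoot a α κ b) (hμ : ∑ i, κ i ^ 2 ≠ μ) (n : ℕ)
    {u : L2Box a} (hu : u ∈ kerPow a α μ n) :
    inner ℂ (modeLp a (fun i => (starRingEnd ℂ) (κ i)) b) u = 0 := by
  induction n generalizing u with
  | zero => rw [(Submodule.mem_bot ℂ).1 hu, inner_zero_right]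
  | succ n ih =>
    obtain ⟨⟨v, f⟩, ⟨hv, hf⟩, rfl⟩ := hu
    have h1 := ih hf
    have h2 := inner_of_mem_robinLaplacian ha h hv
    simp only [LinearMap.sub_apply, LinearMap.smul_apply, LinearMap.snd_apply, LinearMap.fst_apply,
      inner_sub_right, inner_smul_right, h2, ← sub_mul] at h1 ⊢
    exact (mul_eq_zero.1 h1).resolve_left (sub_ne_zero.2 hμ)

lemma kerPow_mono {d : ℕ} (a : Fin d → ℝ) (α μ : ℂ) : Monotone (kerPow a α μ) := by
  refine monotone_nat_of_le_succ fun n => ?_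
  induction n with
  | zero => exact bot_le
  | succ n ih => exact Submodule.map_mono (inf_le_inf_left _ (Submodule.comap_mono ih))

lemma inner_eq_zero_of_mem_iSup_kerPow {d : ℕ} {a : Fin d → ℝ} (ha : ∀ i, 0 < a i) {α μ : ℂ}
    {κ : Fin d → ℂ} {b : Fin d → Bool} (h : IsRoot a α κ b) (hμ : ∑ i, κ i ^ 2 ≠ μ)
    {u : L2Box a} (hu : u ∈ ⨆ n, kerPow a α μ n) :
    inner ℂ (modeLp a (fun i => (starRingEnd ℂ) (κ i)) b) u = 0 := by
  rw [Submodule.mem_iSup_of_directed _ (kerPow_mono a α μ).directed_le] at hu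
  obtain ⟨n, hn⟩ := hu
  exact inner_eq_zero_of_mem_kerPow ha h hμ n hn

lemma mem_iSup_kerPow_of_eigen {d : ℕ} {a : Fin d → ℝ} {α μ : ℂ} {u : L2Box a}
    (hu : (u, μ • u) ∈ robinLaplacian a α) : u ∈ ⨆ n, kerPow a α μ n := by
  refine Submodule.mem_iSup_of_mem 1 ⟨(u, μ • u), ⟨hu, ?_⟩, rfl⟩
  simp [kerPow]

/-! ### Trigonometric estimates -/

lemma normSq_sin (z : ℂ) : ‖Complex.sin z‖ ^ 2 = Real.sin z.re ^ 2 + Real.sinh z.im ^ 2 := by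
  rw [← Complex.normSq_eq_norm_sq, Complex.normSq_apply, Complex.sin_eq]
  have h1 := Real.sin_sq_add_cos_sq z.re
  have h2 := Real.cosh_sq z.im
  simp only [← Complex.ofReal_sin, ← Complex.ofReal_cos, ← Complex.ofReal_sinh,
    ← Complex.ofReal_cosh, ← Complex.ofReal_mul, Complex.add_re, Complex.add_im, Complex.ofReal_re,
    Complex.ofReal_im, Complex.re_ofReal_mul, Complex.im_ofReal_mul, Complex.I_re, Complex.I_im,
    mul_zero, mul_one, zero_add, add_zero]
  linear_combination Real.sin z.re ^ 2 * h2 + Real.sinh z.im ^ 2 * h1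

lemma normSq_cos (z : ℂ) : ‖Complex.cos z‖ ^ 2 = Real.cos z.re ^ 2 + Real.sinh z.im ^ 2 := by
  rw [← Complex.normSq_eq_norm_sq, Complex.normSq_apply, Complex.cos_eq]
  have h1 := Real.sin_sq_add_cos_sq z.re
  have h2 := Real.cosh_sq z.im
  simp only [← Complex.ofReal_sin, ← Complex.ofReal_cos, ← Complex.ofReal_sinh,
    ← Complex.ofReal_cosh, ← Complex.ofReal_mul, Complex.sub_re, Complex.sub_im, Complex.ofReal_re,
    Complex.ofReal_im, Complex.re_ofReal_mul, Complex.im_ofReal_mul, Complex.I_re, Complex.I_im,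
    mul_zero, mul_one, zero_sub, sub_zero]
  linear_combination Real.cos z.re ^ 2 * h2 + Real.sinh z.im ^ 2 * h1

lemma norm_sin_le_cosh (z : ℂ) : ‖Complex.sin z‖ ≤ Real.cosh z.im := by
  have h := normSq_sin z
  have h1 := Real.sin_sq_add_cos_sq z.re
  have h2 := Real.cosh_sq z.im
  exact le_of_abs_le (abs_le_of_sq_le_sq (by nlinarith [sq_nonneg (Real.cos z.re)])
    (Real.cosh_pos _).le)

lemma norm_cos_le_cosh (z : ℂ) : ‖Complex.cos z‖ ≤ Real.cosh z.im := by
  have h := normSq_cos z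
  have h1 := Real.sin_sq_add_cos_sq z.re
  have h2 := Real.cosh_sq z.im
  exact le_of_abs_le (abs_le_of_sq_le_sq (by nlinarith [sq_nonneg (Real.sin z.re)])
    (Real.cosh_pos _).le)

lemma abs_le_abs_sinh (x : ℝ) : |x| ≤ |Real.sinh x| := by
  rw [Real.abs_sinh]
  exact Real.self_le_sinh_iff.2 (abs_nonneg x)

lemma cosh_le_two_mul_abs_sinh {x : ℝ} (hx : 1 ≤ |x|) : Real.cosh x ≤ 2 * |Real.sinh x| := by
  have h1 := abs_le_abs_sinh x
  have h2 := Real.cosh_sq x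
  refine le_of_abs_le (abs_le_of_sq_le_sq ?_ (by positivity))
  rw [mul_pow, sq_abs]
  nlinarith [sq_abs (Real.sinh x), abs_nonneg (Real.sinh x)]

lemma im_phase (b : Bool) : (phase b).im = 0 := by cases b <;> simp [phase]

/-! ### Simplicity of the zeros of the characteristic function. -/

lemma differentiable_charFn (b : Bool) (A : ℂ) : Differentiable ℂ (charFn b A) := by
  unfold charFn
  fun_prop

lemma hasDerivAt_charFn (b : Bool) (A z : ℂ) :
    HasDerivAt (charFn b A) (Complex.sin (z - phase b) + z * Complex.cos (z - phase b)
      + A * Complex.sin (z - phase b)) z := by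
  have h0 : HasDerivAt (fun z : ℂ => z - phase b) 1 z := (hasDerivAt_id z).sub_const _
  exact (((hasDerivAt_id z).mul h0.csin).sub (h0.ccos.const_mul A)).congr_deriv
    (by simp only [id]; ring)

/-- The characteristic function has only simple zeros, if `A` is large and not close to the
imaginary axis. -/
lemma deriv_charFn_ne_zero {b : Bool} {A z : ℂ} (hA : 2 * ‖A‖ < A.re ^ 2)
    (h : charFn b A z = 0) : deriv (charFn b A) z ≠ 0 := by
  rw [(hasDerivAt_charFn b A z).deriv]
  intro h'
  unfold charFn at h
  set S := Complex.sin (z - phase b) with hS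
  set C := Complex.cos (z - phase b)
  have hSC : S ^ 2 + C ^ 2 = 1 := Complex.sin_sq_add_cos_sq _
  have hA0 : A ≠ 0 := by rintro rfl; simp at hA
  -- At a double zero two homogeneous linear equations hold for `(S, C)`, which is not zero. Their
  -- determinant must vanish, which fixes `z ^ 2`, and then `S ^ 2 = -A`.
  have hz1 : (z ^ 2 + A * (1 + A)) * S = 0 := by linear_combination z * h + A * h'
  have hz2 : (z ^ 2 + A * (1 + A)) * C = 0 := by linear_combination z * h' - (1 + A) * h
  have hz : z ^ 2 = -(A * (1 + A)) := by linear_combination -(z ^ 2 + A * (1 + A)) * hSC +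
    S * hz1 + C * hz2
  have hS2 : S ^ 2 = -A := by
    have h3 : z ^ 2 * S ^ 2 = A ^ 2 * C ^ 2 := by linear_combination (z * S + A * C) * h
    apply mul_left_cancel₀ hA0
    linear_combination -h3 + S ^ 2 * hz - A ^ 2 * hSC
  -- The contradiction: the size of the sine forces `im z` to be small, whereas `2 (im z) ^ 2 = |z ^
  -- 2| - re (z ^ 2)` and the formula for `z ^ 2` give `(im z) ^ 2 ≥ (re A) ^ 2 - ‖A‖`.
  have h4 : z.im ^ 2 ≤ ‖A‖ := by
    have e : ‖S‖ ^ 2 = ‖A‖ := by rw [← norm_pow, hS2, norm_neg]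
    have h5 := normSq_sin (z - phase b)
    rw [← hS, e, Complex.sub_im, im_phase, sub_zero] at h5
    have h6 := sq_le_sq.2 (abs_le_abs_sinh z.im)
    nlinarith [sq_nonneg (Real.sin (z - phase b).re)]
  have h7 : 2 * z.im ^ 2 = ‖A‖ * ‖1 + A‖ + (A * (1 + A)).re := by
    have e1 : ‖z‖ ^ 2 = ‖A‖ * ‖1 + A‖ := by rw [← norm_pow, hz, norm_neg, norm_mul]
    have e2 := congrArg Complex.re hz
    rw [← e1, ← Complex.normSq_eq_norm_sq, Complex.normSq_apply]
    simp only [pow_two, Complex.mul_re, Complex.neg_re] at e2 ⊢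
    linarith
  have h8 : ‖A‖ - 1 ≤ ‖1 + A‖ := by
    have := norm_sub_le (1 + A) 1
    rw [add_sub_cancel_left, norm_one] at this
    linarith
  have h9 : ‖A‖ ^ 2 = A.re ^ 2 + A.im ^ 2 := by
    rw [← Complex.normSq_eq_norm_sq, Complex.normSq_apply]; ring
  have h10 : -‖A‖ ≤ A.re := (abs_le.1 (Complex.abs_re_le_norm A)).1
  simp only [Complex.mul_re, Complex.add_re, Complex.one_re, Complex.add_im, Complex.one_im] at h7
  nlinarith [norm_nonneg A]

/-! ### Entire functions vanishing at the zeros of another one -/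

/-- Near a zero of `F` the quotient is that of the two difference quotients, which are entire, and
the denominator is not zero because the zero is simple. The value assigned at the zero is the limit.
-/
lemma differentiable_div_of_simple_zeros {F G : ℂ → ℂ} (hF : Differentiable ℂ F)
    (hG : Differentiable ℂ G) (hs : ∀ z, F z = 0 → deriv F z ≠ 0) (hFG : ∀ z, F z = 0 → G z = 0) :
    ∃ Φ : ℂ → ℂ, Differentiable ℂ Φ ∧ ∀ z, G z = Φ z * F z := by
  classical
  refine ⟨fun z => if F z = 0 then deriv G z / deriv F z else G z / F z, fun z => ?_, fun z => ?_⟩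
  · by_cases h0 : F z = 0
    · have dF : Differentiable ℂ (dslope F z) := differentiableOn_univ.1
        ((Complex.differentiableOn_dslope univ_mem).2 hF.differentiableOn)
      have dG : Differentiable ℂ (dslope G z) := differentiableOn_univ.1
        ((Complex.differentiableOn_dslope univ_mem).2 hG.differentiableOn)
      have hne : dslope F z z ≠ 0 := by rw [dslope_same]; exact hs z h0
      refine ((dG z).div (dF z) hne).congr_of_eventuallyEq ?_
      filter_upwards [(dF z).continuousAt.eventually_ne hne] with w hw
      rcases eq_or_ne w z with rfl | hwz
      · simp [h0, dslope_same]
      · have hwz' : w - z ≠ 0 := sub_ne_zero.2 hwz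
        rw [dslope_of_ne _ hwz, slope_def_field, h0, sub_zero] at hw
        have hFw : F w ≠ 0 := fun h => hw (by rw [h, zero_div])
        rw [if_neg hFw, Pi.div_apply, dslope_of_ne _ hwz, dslope_of_ne _ hwz, slope_def_field,
          slope_def_field, h0, hFG z h0, sub_zero, sub_zero, div_div_div_cancel_right₀ hwz']
    · refine ((hG z).div (hF z) h0).congr_of_eventuallyEq ?_
      filter_upwards [(hF z).continuousAt.eventually_ne h0] with w hw
      simp [hw]
  · by_cases h0 : F z = 0
    · simp [h0, hFG z h0]
    · simp [h0]

/-- The maximum principle for the entire quotient: it is at most `ε` on the frontier of a bounded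
set around any given point. -/
lemma eq_zero_of_simple_zeros {F G : ℂ → ℂ} (hF : Differentiable ℂ F)
    (hG : Differentiable ℂ G) (hs : ∀ z, F z = 0 → deriv F z ≠ 0) (hFG : ∀ z, F z = 0 → G z = 0)
    (hb : ∀ ε > 0, ∀ z₀ : ℂ, ∃ U : Set ℂ, Bornology.IsBounded U ∧ z₀ ∈ U ∧
      ∀ z ∈ frontier U, F z ≠ 0 ∧ ‖G z‖ ≤ ε * ‖F z‖) (z : ℂ) : G z = 0 := by
  obtain ⟨Φ, hΦ, h⟩ := differentiable_div_of_simple_zeros hF hG hs hFG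
  suffices hz : Φ z = 0 by rw [h, hz, zero_mul]
  refine norm_eq_zero.1 (le_antisymm (le_of_forall_pos_le_add fun ε hε => ?_) (norm_nonneg _))
  obtain ⟨U, hU, hzU, hfr⟩ := hb ε hε z
  rw [zero_add]
  refine Complex.norm_le_of_forall_mem_frontier_norm_le hU hΦ.diffContOnCl (fun w hw => ?_)
    (subset_closure hzU)
  obtain ⟨h1, h2⟩ := hfr w hw
  rw [h, norm_mul] at h2
  exact le_of_mul_le_mul_right h2 (norm_pos_iff.2 h1)

/-- On large squares the characteristic function dominates `cosh (im z)`. -/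
lemma exists_square_charFn (b : Bool) (A : ℂ) (M : ℝ) (z₀ : ℂ) :
    ∃ U : Set ℂ, Bornology.IsBounded U ∧ z₀ ∈ U ∧
      ∀ z ∈ frontier U, M * Real.cosh z.im ≤ ‖charFn b A z‖ := by
  -- The vertical sides are placed where the shifted sine of the real part is `±1`; there the
  -- modulus of the complex sine equals `cosh (im z)`.
  set p : ℝ := if b then 0 else Real.pi / 2 with hp
  obtain ⟨N, hN⟩ := exists_nat_gt (‖z₀‖ + 2 * (|M| + ‖A‖) + 1)
  set R : ℝ := N * Real.pi + p with hR
  have hp0 : 0 ≤ p := by rw [hp]; split_ifs <;> positivity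
  have hRN : (N : ℝ) ≤ R := by nlinarith [Real.pi_gt_three, N.cast_nonneg (α := ℝ)]
  have hRpos : 1 ≤ R := by nlinarith [norm_nonneg z₀, abs_nonneg M, norm_nonneg A]
  have hsin : ∀ z : ℂ, |z.re| = R → Real.sin (z - phase b).re ^ 2 = 1 := by
    intro z hz
    have hc : ∀ x : ℝ, Real.cos x = 0 → Real.sin x ^ 2 = 1 := fun x hx => by
      have := Real.sin_sq_add_cos_sq x
      rw [hx] at this; linarith
    apply hc
    have hcN : Real.sin (N * Real.pi) = 0 := Real.sin_nat_mul_pi N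
    cases b
    · have e : Real.cos R = 0 := by
        rw [hR, hp]; simp [Real.cos_add_pi_div_two, hcN]
      simp only [phase, Bool.false_eq_true, if_false, sub_zero]
      rw [← Real.cos_abs, hz, e]
    · have e : Real.sin R = 0 := by rw [hR, hp]; simp
      simp only [phase, if_true, Complex.sub_re, Complex.ofReal_re, Real.cos_sub_pi_div_two]
      rcases abs_choice z.re with h | h <;> rw [h] at hz
      · rw [hz, e]
      · rw [← neg_eq_zero, ← Real.sin_neg, hz, e]
  -- The factor `z` of the sine wins: `R / 2` exceeds `|M| + ‖A‖`.
  have key : ∀ z : ℂ, R ≤ ‖z‖ → Real.cosh z.im ≤ 2 * ‖Complex.sin (z - phase b)‖ →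
      M * Real.cosh z.im ≤ ‖charFn b A z‖ := by
    intro z hz hs
    have h1 := norm_cos_le_cosh (z - phase b)
    rw [Complex.sub_im, im_phase, sub_zero] at h1
    have h2 : ‖z‖ * ‖Complex.sin (z - phase b)‖ - ‖A‖ * ‖Complex.cos (z - phase b)‖ ≤
        ‖charFn b A z‖ := by
      rw [← norm_mul, ← norm_mul]; exact norm_sub_norm_le _ _
    have h3 : R * (Real.cosh z.im / 2) ≤ ‖z‖ * ‖Complex.sin (z - phase b)‖ := by
      have := Real.cosh_pos z.im
      gcongr
      linarith
    have h4 : ‖A‖ * ‖Complex.cos (z - phase b)‖ ≤ ‖A‖ * Real.cosh z.im := by gcongr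
    have h5 : M + ‖A‖ ≤ R / 2 := by linarith [le_abs_self M, norm_nonneg z₀]
    nlinarith [Real.cosh_pos z.im]
  refine ⟨Set.Ioo (-R) R ×ℂ Set.Ioo (-R) R,
    (Metric.isBounded_Ioo _ _).reProdIm (Metric.isBounded_Ioo _ _), ?_, fun z hz => ?_⟩
  · have h1 := Complex.abs_re_le_norm z₀
    have h2 := Complex.abs_im_le_norm z₀
    have h3 : ‖z₀‖ < R := by linarith [abs_nonneg M, norm_nonneg A]
    exact ⟨abs_lt.1 (h1.trans_lt h3), abs_lt.1 (h2.trans_lt h3)⟩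
  · have hlt : -R < R := by linarith
    rw [Complex.frontier_reProdIm, frontier_Ioo hlt] at hz
    rcases hz with hz | hz
    · have him : |z.im| = R := by
        rcases hz.2 with h | h
        · rw [h, abs_neg, abs_of_nonneg (by linarith)]
        · rw [Set.mem_singleton_iff.1 h, abs_of_nonneg (by linarith)]
      refine key z (him ▸ Complex.abs_im_le_norm z) ?_
      refine (cosh_le_two_mul_abs_sinh (him ▸ hRpos)).trans ?_
      gcongr
      have h5 := normSq_sin (z - phase b)
      rw [Complex.sub_im, im_phase, sub_zero] at h5
      refine le_of_abs_le (abs_le_of_sq_le_sq ?_ (norm_nonneg _))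
      rw [sq_abs, h5]
      nlinarith [sq_nonneg (Real.sin (z - phase b).re)]
    · have hre : |z.re| = R := by
        rcases hz.1 with h | h
        · rw [h, abs_neg, abs_of_nonneg (by linarith)]
        · rw [Set.mem_singleton_iff.1 h, abs_of_nonneg (by linarith)]
      refine key z (hre ▸ Complex.abs_re_le_norm z) ?_
      have h5 := normSq_sin (z - phase b)
      rw [hsin z hre, Complex.sub_im, im_phase, sub_zero, add_comm, ← Real.cosh_sq] at h5
      have h6 := (sq_eq_sq₀ (norm_nonneg _) (Real.cosh_pos z.im).le).1 h5
      rw [h6]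
      linarith [Real.cosh_pos z.im]

/-- An entire function of exponential type one on the imaginary direction that vanishes at the
zeros of the characteristic function is zero. -/
lemma eq_zero_of_zeros_charFn {b : Bool} {A : ℂ} (hA : 2 * ‖A‖ < A.re ^ 2) {G : ℂ → ℂ}
    (hG : Differentiable ℂ G) {M : ℝ} (hM : ∀ z, ‖G z‖ ≤ M * Real.cosh z.im)
    (h0 : ∀ z, charFn b A z = 0 → G z = 0) (z : ℂ) : G z = 0 := by
  refine eq_zero_of_simple_zeros (differentiable_charFn b A) hG
    (fun w hw => deriv_charFn_ne_zero hA hw) h0 (fun ε hε z₀ => ?_) z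
  -- The summand `1` keeps the lower bound positive even for `M = 0`, so that the characteristic
  -- function has no zero on the frontier.
  obtain ⟨U, hU, hzU, hfr⟩ := exists_square_charFn b A (|M| / ε + 1) z₀
  refine ⟨U, hU, hzU, fun w hw => ?_⟩
  have h1 := hfr w hw
  have hc := Real.cosh_pos w.im
  refine ⟨fun h => ?_, ?_⟩
  · rw [h, norm_zero] at h1
    have : 0 < (|M| / ε + 1) * Real.cosh w.im := by positivity
    linarith
  · calc ‖G w‖ ≤ M * Real.cosh w.im := hM w
      _ ≤ |M| * Real.cosh w.im := by gcongr; exact le_abs_self M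
      _ = ε * (|M| / ε * Real.cosh w.im) := by field_simp
      _ ≤ ε * ‖charFn b A w‖ := by
        gcongr
        refine le_trans ?_ h1
        gcongr
        linarith

/-! ### Completeness of the modes -/

lemma cosh_mul_le {t y r : ℝ} (ht : |t| ≤ 1) (hy : |y| ≤ r) : Real.cosh (t * y) ≤ Real.cosh r := by
  rw [Real.cosh_le_cosh, abs_mul, abs_of_nonneg ((abs_nonneg y).trans hy)]
  calc |t| * |y| ≤ 1 * |y| := by gcongr
    _ ≤ r := by rwa [one_mul]

lemma im_mul_sub_phase (b : Bool) (z : ℂ) (t : ℝ) : (z * t - phase b).im = t * z.im := by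
  rw [Complex.sub_im, im_phase, sub_zero, Complex.im_mul_ofReal, mul_comm]

/-- The cosine transform of an integrable function with frequencies in `[-1, 1]` is entire. -/
lemma differentiable_integral_cos {X : Type*} [MeasurableSpace X] {μ : Measure X} {V : X → ℂ}
    (hV : Integrable V μ) {τ : X → ℝ} (hτ : Measurable τ) (hτ1 : ∀ᵐ x ∂μ, |τ x| ≤ 1) (b : Bool) :
    Differentiable ℂ fun z : ℂ => ∫ x, V x * Complex.cos (z * τ x - phase b) ∂μ := by
  intro z
  have hm : ∀ w : ℂ, AEStronglyMeasurable (fun x => Complex.cos (w * τ x - phase b)) μ := fun w =>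
    (Complex.measurable_cos.comp (((Complex.measurable_ofReal.comp hτ).const_mul w).sub_const
      _)).aestronglyMeasurable
  have hm' : AEStronglyMeasurable
      (fun x => V x * -(τ x * Complex.sin (z * τ x - phase b))) μ :=
    hV.1.mul (((Complex.measurable_ofReal.comp hτ).mul (Complex.measurable_sin.comp
      (((Complex.measurable_ofReal.comp hτ).const_mul z).sub_const _))).neg.aestronglyMeasurable)
  refine (hasDerivAt_integral_of_dominated_loc_of_deriv_le
    (F' := fun w x => V x * -(τ x * Complex.sin (w * τ x - phase b)))
    (bound := fun x => ‖V x‖ * Real.cosh (|z.im| + 1)) (Metric.ball_mem_nhds z one_pos)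
    (Eventually.of_forall fun w => hV.1.mul (hm w)) ?_ hm' ?_ (hV.norm.mul_const _) ?_).2
    |>.differentiableAt
  · refine hV.mul_bdd (c := Real.cosh |z.im|) (hm z) ?_
    filter_upwards [hτ1] with x hx
    refine (norm_cos_le_cosh _).trans ?_
    rw [im_mul_sub_phase]
    exact cosh_mul_le hx le_rfl
  · filter_upwards [hτ1] with x hx w hw
    have h1 : |w.im| ≤ |z.im| + 1 := by
      have h2 : |w.im - z.im| ≤ 1 := by
        rw [← Complex.sub_im]
        exact (Complex.abs_im_le_norm _).trans (mem_ball_iff_norm.1 hw).le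
      calc |w.im| = |z.im + (w.im - z.im)| := by congr 1; ring
        _ ≤ _ := (abs_add_le _ _).trans (by linarith)
    have h3 := norm_sin_le_cosh (w * τ x - phase b)
    rw [im_mul_sub_phase] at h3
    have h4 := h3.trans (cosh_mul_le hx h1)
    rw [norm_mul, norm_neg, norm_mul, Complex.norm_real, Real.norm_eq_abs]
    have h5 : |τ x| * ‖Complex.sin (w * τ x - phase b)‖ ≤ 1 * Real.cosh (|z.im| + 1) := by gcongr
    rw [one_mul] at h5
    gcongr
  · refine Eventually.of_forall fun x w _ => ?_
    have h : HasDerivAt (fun w : ℂ => w * τ x - phase b) (τ x : ℂ) w := by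
      simpa using ((hasDerivAt_id w).mul_const (τ x : ℂ)).sub_const (phase b)
    exact (h.ccos.const_mul (V x)).congr_deriv (by ring)

lemma norm_integral_cos_le {X : Type*} [MeasurableSpace X] {μ : Measure X} {V : X → ℂ}
    (hV : Integrable V μ) {τ : X → ℝ} (hτ1 : ∀ᵐ x ∂μ, |τ x| ≤ 1) (b : Bool) (z : ℂ) :
    ‖∫ x, V x * Complex.cos (z * τ x - phase b) ∂μ‖ ≤ (∫ x, ‖V x‖ ∂μ) * Real.cosh z.im := by
  rw [← integral_mul_const]
  refine norm_integral_le_of_norm_le (hV.norm.mul_const _) ?_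
  filter_upwards [hτ1] with x hx
  rw [norm_mul]
  gcongr
  refine (norm_cos_le_cosh _).trans ?_
  rw [im_mul_sub_phase, ← Real.cosh_abs z.im]
  exact cosh_mul_le hx le_rfl

lemma modeProd_update {d : ℕ} (κ : Fin d → ℂ) (b : Fin d → Bool) (j : Fin d) (k : ℂ)
    (x : Fin d → ℝ) : modeProd (Function.update κ j k) b x =
      (∏ i ∈ Finset.univ.erase j, Complex.cos (κ i * x i - phase (b i))) *
        Complex.cos (k * x j - phase (b j)) := by
  rw [modeProd, ← Finset.mul_prod_erase _ _ (Finset.mem_univ j), mul_comm, Function.update_self]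
  congr 1
  refine Finset.prod_congr rfl fun i hi => ?_
  rw [Function.update_of_ne (Finset.ne_of_mem_erase hi)]

/-- The root condition is removed one coordinate at a time, `s` being the set of coordinates with
free frequency. As a function of `z = κ j * a j` the integral is a cosine transform, and by
induction it vanishes at all roots of the coordinate `j`. -/
lemma integral_modeProd_eq_zero {d : ℕ} {a : Fin d → ℝ} (ha : ∀ i, 0 < a i) {α : ℂ}
    (hα : ∀ i, 2 * ‖α * a i‖ < (α * a i).re ^ 2) {u : L2Box a}
    (h : ∀ κ b, IsRoot a α κ b → ∫ x, u x * modeProd κ b x ∂(boxMeasure a) = 0)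
    (κ : Fin d → ℂ) (b : Fin d → Bool) : ∫ x, u x * modeProd κ b x ∂(boxMeasure a) = 0 := by
  suffices hs : ∀ s : Finset (Fin d), ∀ κ b,
      (∀ i ∉ s, charFn (b i) (α * a i) (κ i * a i) = 0) →
      ∫ x, u x * modeProd κ b x ∂(boxMeasure a) = 0 from
    hs Finset.univ κ b fun i hi => absurd (Finset.mem_univ i) hi
  intro s
  induction s using Finset.induction_on with
  | empty => exact fun κ b hr => h κ b fun i => hr i (Finset.notMem_empty i)
  | insert j s hj ih =>
    intro κ b hr
    have haj : (a j : ℂ) ≠ 0 := by exact_mod_cast (ha j).ne'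
    set rest : (Fin d → ℝ) → ℂ := fun x =>
      ∏ i ∈ Finset.univ.erase j, Complex.cos (κ i * x i - phase (b i)) with hrest
    have hrc : Continuous rest := by fun_prop
    have hV := integrable_mul_continuous a u hrc
    have hτ : Measurable fun x : Fin d → ℝ => x j / a j := by fun_prop
    have hτ1 : ∀ᵐ x ∂(boxMeasure a), |x j / a j| ≤ 1 := by
      filter_upwards [ae_boxMeasure_mem_Icc a] with x hx
      rw [abs_div, abs_of_pos (ha j), div_le_one (ha j), abs_le]
      exact ⟨hx.1 j, hx.2 j⟩
    have hG : ∀ z : ℂ, ∫ x, u x * rest x * Complex.cos (z * (x j / a j : ℝ) - phase (b j))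
        ∂(boxMeasure a) = ∫ x, u x * modeProd (Function.update κ j (z / a j)) b x
        ∂(boxMeasure a) := by
      intro z
      refine integral_congr_ae (Eventually.of_forall fun x => ?_)
      simp only [modeProd_update]
      rw [mul_assoc]
      congr 4
      push_cast
      ring
    have key := eq_zero_of_zeros_charFn (b := b j) (hα j)
      (differentiable_integral_cos hV hτ hτ1 (b j)) (norm_integral_cos_le hV hτ1 (b j))
      (fun z hz => by
        rw [hG]
        refine ih _ _ fun i hi => ?_
        rcases eq_or_ne i j with rfl | hij
        · rw [Function.update_self, div_mul_cancel₀ _ haj, hz]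
        · rw [Function.update_of_ne hij]
          exact hr i fun hmem => (Finset.mem_insert.1 hmem).elim hij hi) (κ j * a j)
    rw [hG, mul_div_cancel_right₀ _ haj, Function.update_eq_self] at key
    exact key

lemma exp_eq_sum_cos (w : ℂ) : Complex.exp (w * Complex.I) =
    ∑ c : Bool, (if c then Complex.I else 1) * Complex.cos (w - phase c) := by
  simp [phase, Complex.exp_mul_I, Complex.cos_sub_pi_div_two]
  ring

/-- Expanding `cos + i sin` in every coordinate writes a plane wave as a combination of modes with
real frequencies, one for each choice of parities. -/
lemma integral_exp_eq_zero {d : ℕ} {a : Fin d → ℝ} {u : L2Box a}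
    (h : ∀ κ b, ∫ x, u x * modeProd κ b x ∂(boxMeasure a) = 0) (ξ : Fin d → ℝ) :
    ∫ x, u x * Complex.exp ((∑ i, ξ i * x i : ℝ) * Complex.I) ∂(boxMeasure a) = 0 := by
  have e : ∀ x : Fin d → ℝ, Complex.exp ((∑ i, ξ i * x i : ℝ) * Complex.I) =
      ∑ c : Fin d → Bool, (∏ i, if c i then Complex.I else 1) * modeProd (fun i => (ξ i : ℂ)) c x := by
    intro x
    push_cast
    rw [Finset.sum_mul, Complex.exp_sum]
    simp only [exp_eq_sum_cos, Fintype.prod_sum, Finset.prod_mul_distrib, modeProd]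
  simp only [e, Finset.mul_sum]
  rw [integral_finsetSum]
  · refine Finset.sum_eq_zero fun c _ => ?_
    simp only [mul_left_comm (u _)]
    rw [integral_const_mul, h, mul_zero]
  · intro c _
    exact integrable_mul_continuous a u
      (continuous_const.mul (contDiff_modeProd _ c).continuous)

/-- The positive and the negative part are densities of finite measures with the same characteristic
function, so these measures agree. -/
lemma ae_eq_zero_of_integral_exp_eq_zero_real {E : Type*} [NormedAddCommGroup E] [NormedSpace ℝ E]
    [MeasurableSpace E] [BorelSpace E] [SecondCountableTopology E] [CompleteSpace E]
    {μ : Measure E} {v : E → ℝ} (hv : Integrable v μ)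
    (h : ∀ L : StrongDual ℝ E, ∫ x, (v x : ℂ) * Complex.exp (L x * Complex.I) ∂μ = 0) :
    v =ᵐ[μ] 0 := by
  have hm : AEMeasurable (fun x => ENNReal.ofReal (v x)) μ := hv.aemeasurable.ennreal_ofReal
  have hm' : AEMeasurable (fun x => ENNReal.ofReal (-v x)) μ := hv.neg.aemeasurable.ennreal_ofReal
  have hf : ∫⁻ x, ENNReal.ofReal (v x) ∂μ ≠ ⊤ := hv.lintegral_lt_top.ne
  have hf' : ∫⁻ x, ENNReal.ofReal (-v x) ∂μ ≠ ⊤ := hv.neg.lintegral_lt_top.ne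
  have := isFiniteMeasure_withDensity hf
  have := isFiniteMeasure_withDensity hf'
  have key : μ.withDensity (fun x => ENNReal.ofReal (v x)) =
      μ.withDensity (fun x => ENNReal.ofReal (-v x)) := by
    refine Measure.ext_of_charFunDual (funext fun L => ?_)
    have hmE : AEStronglyMeasurable (fun x => Complex.exp (L x * Complex.I)) μ :=
      (by fun_prop : Continuous fun x => Complex.exp (L x * Complex.I)).aestronglyMeasurable
    have hb : ∀ᵐ x ∂μ, ‖Complex.exp (L x * Complex.I)‖ ≤ 1 :=
      Eventually.of_forall fun x => (Complex.norm_exp_ofReal_mul_I _).le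
    rw [charFunDual_apply, charFunDual_apply, integral_withDensity_eq_integral_toReal_smul₀ hm
      (Eventually.of_forall fun _ => ENNReal.ofReal_lt_top),
      integral_withDensity_eq_integral_toReal_smul₀ hm'
      (Eventually.of_forall fun _ => ENNReal.ofReal_lt_top), ← sub_eq_zero, ← integral_sub]
    · rw [← h L]
      refine integral_congr_ae (Eventually.of_forall fun x => ?_)
      simp only [ENNReal.toReal_ofReal', Complex.real_smul]
      rcases le_total (v x) 0 with h0 | h0
      · rw [max_eq_right h0, max_eq_left (by linarith)]; push_cast; ring
      · rw [max_eq_left h0, max_eq_right (by linarith)]; push_cast; ring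
    · simp only [ENNReal.toReal_ofReal', Complex.real_smul]
      exact (hv.pos_part.ofReal (𝕜 := ℂ)).mul_bdd hmE hb
    · simp only [ENNReal.toReal_ofReal', Complex.real_smul]
      exact (hv.neg_part.ofReal (𝕜 := ℂ)).mul_bdd hmE hb
  rw [withDensity_eq_iff hm hm' hf] at key
  filter_upwards [key] with x hx
  have h1 := congrArg ENNReal.toReal hx
  simp only [ENNReal.toReal_ofReal'] at h1
  rcases le_total (v x) 0 with h0 | h0
  · rw [max_eq_right h0, max_eq_left (by linarith)] at h1
    change v x = 0
    linarith
  · rw [max_eq_left h0, max_eq_right (by linarith)] at h1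
    exact h1

/-- Conjugating the condition at `-L` gives the condition at `L` for the conjugate of `v`, hence for
the real and imaginary parts. -/
lemma ae_eq_zero_of_integral_exp_eq_zero {E : Type*} [NormedAddCommGroup E] [NormedSpace ℝ E]
    [MeasurableSpace E] [BorelSpace E] [SecondCountableTopology E] [CompleteSpace E]
    {μ : Measure E} {v : E → ℂ} (hv : Integrable v μ)
    (h : ∀ L : StrongDual ℝ E, ∫ x, v x * Complex.exp (L x * Complex.I) ∂μ = 0) :
    v =ᵐ[μ] 0 := by
  have hmE : ∀ L : StrongDual ℝ E,
      AEStronglyMeasurable (fun x => Complex.exp (L x * Complex.I)) μ := fun L =>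
    (by fun_prop : Continuous fun x => Complex.exp (L x * Complex.I)).aestronglyMeasurable
  have hb : ∀ L : StrongDual ℝ E, ∀ᵐ x ∂μ, ‖Complex.exp (L x * Complex.I)‖ ≤ 1 := fun L =>
    Eventually.of_forall fun x => (Complex.norm_exp_ofReal_mul_I _).le
  have hvc : Integrable (fun x => (starRingEnd ℂ) (v x)) μ :=
    (RCLike.conjCLE (K := ℂ)).toContinuousLinearMap.integrable_comp hv
  have hconj : ∀ L : StrongDual ℝ E,
      ∫ x, (starRingEnd ℂ) (v x) * Complex.exp (L x * Complex.I) ∂μ = 0 := by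
    intro L
    have h1 := congrArg (starRingEnd ℂ) (h (-L))
    rw [← integral_conj, map_zero] at h1
    rw [← h1]
    refine integral_congr_ae (Eventually.of_forall fun x => ?_)
    simp [← Complex.exp_conj]
  have hre := ae_eq_zero_of_integral_exp_eq_zero_real hv.re fun L => by
    have e : ∀ x, ((RCLike.re (v x) : ℝ) : ℂ) * Complex.exp (L x * Complex.I) =
        (1 / 2 : ℂ) * (v x * Complex.exp (L x * Complex.I) +
          (starRingEnd ℂ) (v x) * Complex.exp (L x * Complex.I)) := fun x => by
      rw [← add_mul, Complex.add_conj, RCLike.re_to_complex]; push_cast; ring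
    simp only [e]
    rw [integral_const_mul, integral_add (hv.mul_bdd (hmE L) (hb L)) (hvc.mul_bdd (hmE L) (hb L)),
      h, hconj]
    simp
  have him := ae_eq_zero_of_integral_exp_eq_zero_real hv.im fun L => by
    have e : ∀ x, ((RCLike.im (v x) : ℝ) : ℂ) * Complex.exp (L x * Complex.I) =
        (-Complex.I / 2 : ℂ) * (v x * Complex.exp (L x * Complex.I) -
          (starRingEnd ℂ) (v x) * Complex.exp (L x * Complex.I)) := fun x => by
      rw [← sub_mul, Complex.sub_conj, RCLike.im_to_complex]; push_cast; ring_nf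
      rw [Complex.I_sq]; ring
    simp only [e]
    rw [integral_const_mul, integral_sub (hv.mul_bdd (hmE L) (hb L)) (hvc.mul_bdd (hmE L) (hb L)),
      h, hconj]
    simp
  filter_upwards [hre, him] with x h1 h2
  exact Complex.ext h1 h2

/-- The modes of the Robin problem are complete, if all of them are simple. -/
theorem eq_zero_of_inner_modes {d : ℕ} {a : Fin d → ℝ} (ha : ∀ i, 0 < a i) {α : ℂ}
    (hα : ∀ i, 2 * ‖α * a i‖ < (α * a i).re ^ 2) {u : L2Box a}
    (h : ∀ κ b, IsRoot a α κ b →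
      inner ℂ (modeLp a (fun i => (starRingEnd ℂ) (κ i)) b) u = 0) : u = 0 := by
  have h0 := integral_modeProd_eq_zero ha hα (u := u) fun κ b hκ => by
    rw [← h κ b hκ, inner_eq_integral (coeFn_modeLp a _ b) (EventuallyEq.refl _ (u : _ → ℂ))]
    simp only [conj_modeProd, Complex.conj_conj, mul_comm]
  rw [Lp.eq_zero_iff_ae_eq_zero]
  refine ae_eq_zero_of_integral_exp_eq_zero ((Lp.memLp u).integrable (by norm_num)) fun L => ?_
  rw [← integral_exp_eq_zero h0 fun i => L (Pi.single i 1)]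
  refine integral_congr_ae (Eventually.of_forall fun x => ?_)
  have e : L x = ∑ i, L (Pi.single i 1) * x i := by
    conv_lhs => rw [pi_eq_sum_univ' x]
    simp [mul_comm]
  simp only [e]

/-! ### Large roots of the characteristic function -/

/-- `1` for the even and `-1` for the odd modes. -/
def paritySign (b : Bool) : ℂ := if b then -1 else 1

lemma norm_paritySign (b : Bool) : ‖paritySign b‖ = 1 := by cases b <;> simp [paritySign]

lemma cos_neg_sub_phase (b : Bool) (z : ℂ) :
    Complex.cos (-z - phase b) = paritySign b * Complex.cos (z - phase b) := by
  cases b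
  · simp [phase, paritySign]
  · simp [phase, paritySign, Complex.cos_sub_pi_div_two]

lemma charFn_neg (b : Bool) (A z : ℂ) : charFn b A (-z) = paritySign b * charFn b A z := by
  cases b
  · simp [phase, paritySign, charFn]
  · simp [phase, paritySign, charFn, Complex.cos_sub_pi_div_two, Complex.sin_sub_pi_div_two]
    ring

/-- The characteristic equation in the variable `y = -i z`. -/
def IsExpRoot (b : Bool) (B y : ℂ) : Prop :=
  y * (1 - paritySign b * Complex.exp (-2 * y)) = B * (1 + paritySign b * Complex.exp (-2 * y))

/-- Sine and cosine become hyperbolic, and after multiplication by `exp (-y)` only `exp (-2 * y)` is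
left. It is small for large `re y`, so the equation is a perturbation of `y = B`. -/
lemma charFn_I_mul_eq_zero_iff (b : Bool) (B y : ℂ) :
    charFn b (-B) (Complex.I * y) = 0 ↔ IsExpRoot b B y := by
  have hE : Complex.exp (-y) ≠ 0 := Complex.exp_ne_zero _
  have e1 : Complex.exp (-2 * y) = Complex.exp (-y) * Complex.exp (-y) := by
    rw [← Complex.exp_add]; congr 1; ring
  have e2 : Complex.exp y * Complex.exp (-y) = 1 := by rw [← Complex.exp_add]; simp
  have hI := Complex.I_sq
  have hy : Complex.I * y = y * Complex.I := mul_comm _ _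
  rw [IsExpRoot, ← sub_eq_zero (b := B * _), hy]
  cases b
  · have e : y * (1 - paritySign false * Complex.exp (-2 * y)) -
        B * (1 + paritySign false * Complex.exp (-2 * y)) =
        -2 * Complex.exp (-y) * charFn false (-B) (y * Complex.I) := by
      simp only [charFn, phase, paritySign, Bool.false_eq_true, if_false, sub_zero,
        Complex.sin_mul_I, Complex.cos_mul_I, e1, Complex.sinh, Complex.cosh]
      linear_combination (y - B) * (-e2) - y * (Complex.exp y * Complex.exp (-y)
        - Complex.exp (-y) * Complex.exp (-y)) * (-hI)
    rw [e]
    simp [hE]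
  · have e : y * (1 - paritySign true * Complex.exp (-2 * y)) -
        B * (1 + paritySign true * Complex.exp (-2 * y)) =
        2 * Complex.I * Complex.exp (-y) * charFn true (-B) (y * Complex.I) := by
      simp only [charFn, phase, paritySign, if_true, Complex.ofReal_div, Complex.ofReal_ofNat,
        Complex.sin_sub_pi_div_two, Complex.cos_sub_pi_div_two,
        Complex.sin_mul_I, Complex.cos_mul_I, e1, Complex.sinh, Complex.cosh]
      linear_combination (y - B) * (-e2) + (y * (Complex.exp y * Complex.exp (-y)
        + Complex.exp (-y) * Complex.exp (-y)) - B * (Complex.exp y * Complex.exp (-y)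
        - Complex.exp (-y) * Complex.exp (-y))) * hI
    rw [e]
    simp [hE]

lemma norm_exp_le_of_re_ge {ρ : ℝ} {y : ℂ} (hy : ρ ≤ y.re) :
    ‖Complex.exp (-2 * y)‖ ≤ Real.exp (-2 * ρ) := by
  rw [Complex.norm_exp]
  have e : (-2 * y).re = -2 * y.re := by simp
  rw [e]
  exact Real.exp_le_exp.2 (by linarith)

lemma half_le_norm_one_sub {q s : ℂ} (hq : ‖q‖ = 1) (hs : ‖s‖ ≤ 1 / 2) :
    1 / 2 ≤ ‖1 - q * s‖ := by
  have h := norm_sub_norm_le 1 (q * s)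
  rw [norm_one, norm_mul, hq, one_mul] at h
  linarith

lemma half_le_norm_one_add {q s : ℂ} (hq : ‖q‖ = 1) (hs : ‖s‖ ≤ 1 / 2) :
    1 / 2 ≤ ‖1 + q * s‖ := by
  have h := half_le_norm_one_sub (q := -q) (by rwa [norm_neg]) hs
  rwa [neg_mul, sub_neg_eq_add] at h

lemma norm_exp_sub_exp_le {ρ : ℝ} {y₁ y₂ : ℂ} (h₁ : ρ ≤ y₁.re) (h₂ : ρ ≤ y₂.re) :
    ‖Complex.exp (-2 * y₁) - Complex.exp (-2 * y₂)‖ ≤ 2 * Real.exp (-2 * ρ) * ‖y₁ - y₂‖ := by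
  have hd : ∀ y : ℂ, HasDerivAt (fun y => Complex.exp (-2 * y)) (Complex.exp (-2 * y) * (-2)) y :=
    fun y => by simpa using ((hasDerivAt_id y).const_mul (-2 : ℂ)).cexp
  refine Convex.norm_image_sub_le_of_norm_deriv_le (fun y _ => (hd y).differentiableAt)
    (fun y hy => ?_) (convex_halfSpace_re_ge ρ) h₂ h₁
  rw [(hd y).deriv, norm_mul, mul_comm]
  have := norm_exp_le_of_re_ge (ρ := ρ) (y := y) hy
  have e : ‖(-2 : ℂ)‖ = 2 := by simp
  rw [e]
  gcongr

/-- The fixed point map of the equation `IsExpRoot`. -/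
def expRootMap (b : Bool) (B y : ℂ) : ℂ :=
  B * ((1 + paritySign b * Complex.exp (-2 * y)) / (1 - paritySign b * Complex.exp (-2 * y)))

lemma isExpRoot_iff {b : Bool} {B y : ℂ} (hy : ‖Complex.exp (-2 * y)‖ ≤ 1 / 2) :
    IsExpRoot b B y ↔ expRootMap b B y = y := by
  have h := half_le_norm_one_sub (norm_paritySign b) hy
  have h0 : 1 - paritySign b * Complex.exp (-2 * y) ≠ 0 := norm_pos_iff.1 (by linarith)
  rw [IsExpRoot, expRootMap, ← mul_div_assoc, div_eq_iff h0, eq_comm]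

/-- The constant is `16 = 2 * 2 * 4`: from the numerator of the difference of the fractions, the
Lipschitz constant of `exp (-2 * y)`, and two denominators of modulus at least `1 / 2`. -/
lemma norm_expRootMap_sub_le {b : Bool} {B : ℂ} {ρ : ℝ} (hρ : Real.exp (-2 * ρ) ≤ 1 / 2)
    {y₁ y₂ : ℂ} (h₁ : ρ ≤ y₁.re) (h₂ : ρ ≤ y₂.re) :
    ‖expRootMap b B y₁ - expRootMap b B y₂‖ ≤ 16 * ‖B‖ * Real.exp (-2 * ρ) * ‖y₁ - y₂‖ := by
  have q1 := norm_paritySign b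
  have n1 := half_le_norm_one_sub q1 ((norm_exp_le_of_re_ge h₁).trans hρ)
  have n2 := half_le_norm_one_sub q1 ((norm_exp_le_of_re_ge h₂).trans hρ)
  have hs := norm_exp_sub_exp_le h₁ h₂
  unfold expRootMap
  set q := paritySign b
  set s₁ := Complex.exp (-2 * y₁)
  set s₂ := Complex.exp (-2 * y₂)
  have z1 : 1 - q * s₁ ≠ 0 := norm_pos_iff.1 (by linarith)
  have z2 : 1 - q * s₂ ≠ 0 := norm_pos_iff.1 (by linarith)
  have e : B * ((1 + q * s₁) / (1 - q * s₁)) - B * ((1 + q * s₂) / (1 - q * s₂)) =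
      B * (2 * q * (s₁ - s₂)) / ((1 - q * s₁) * (1 - q * s₂)) := by
    field_simp
    ring
  have hden : 1 / 4 ≤ ‖1 - q * s₁‖ * ‖1 - q * s₂‖ := by nlinarith
  rw [e, norm_div, norm_mul, norm_mul, norm_mul, norm_mul, q1, div_le_iff₀ (by linarith)]
  have e2 : ‖(2 : ℂ)‖ = 2 := by simp
  rw [e2, mul_one]
  calc ‖B‖ * (2 * ‖s₁ - s₂‖) ≤ ‖B‖ * (2 * (2 * Real.exp (-2 * ρ) * ‖y₁ - y₂‖)) := by gcongr
    _ = 16 * ‖B‖ * Real.exp (-2 * ρ) * ‖y₁ - y₂‖ * (1 / 4) := by ring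
    _ ≤ _ := by gcongr

lemma norm_expRootMap_sub_self_le {b : Bool} {B : ℂ} {ρ : ℝ} (hρ : Real.exp (-2 * ρ) ≤ 1 / 2)
    {y : ℂ} (h : ρ ≤ y.re) : ‖expRootMap b B y - B‖ ≤ 4 * ‖B‖ * Real.exp (-2 * ρ) := by
  have q1 := norm_paritySign b
  have hs := norm_exp_le_of_re_ge h
  have n1 := half_le_norm_one_sub q1 (hs.trans hρ)
  unfold expRootMap
  set q := paritySign b
  set s := Complex.exp (-2 * y)
  have z1 : 1 - q * s ≠ 0 := norm_pos_iff.1 (by linarith)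
  have e : B * ((1 + q * s) / (1 - q * s)) - B = B * (2 * q * s) / (1 - q * s) := by
    field_simp
    ring
  rw [e, norm_div, norm_mul, norm_mul, norm_mul, q1, div_le_iff₀ (by linarith)]
  have e2 : ‖(2 : ℂ)‖ = 2 := by simp
  rw [e2, mul_one]
  calc ‖B‖ * (2 * ‖s‖) ≤ ‖B‖ * (2 * Real.exp (-2 * ρ)) := by gcongr
    _ = 4 * ‖B‖ * Real.exp (-2 * ρ) * (1 / 2) := by ring
    _ ≤ _ := by gcongr

/-- A contraction has at most one fixed point. The free `ρ` may be far below `re B`, as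
`eventually_root_dichotomy` requires. -/
lemma IsExpRoot.unique {b : Bool} {B : ℂ} {ρ : ℝ} (hρ : Real.exp (-2 * ρ) ≤ 1 / 2)
    (hB : 16 * ‖B‖ * Real.exp (-2 * ρ) < 1) {y₁ y₂ : ℂ} (h₁ : ρ ≤ y₁.re) (h₂ : ρ ≤ y₂.re)
    (r₁ : IsExpRoot b B y₁) (r₂ : IsExpRoot b B y₂) : y₁ = y₂ := by
  have h := norm_expRootMap_sub_le (b := b) (B := B) hρ h₁ h₂
  rw [(isExpRoot_iff ((norm_exp_le_of_re_ge h₁).trans hρ)).1 r₁,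
    (isExpRoot_iff ((norm_exp_le_of_re_ge h₂).trans hρ)).1 r₂] at h
  by_contra hne
  have : 0 < ‖y₁ - y₂‖ := norm_pos_iff.2 (sub_ne_zero.2 hne)
  nlinarith

/-- The parameters for which the large root is defined. -/
def IsLarge (B : ℂ) : Prop := 1 < B.re ∧ 32 * ‖B‖ * Real.exp (-B.re) < 1

lemma isOpen_setOf_isLarge : IsOpen {B : ℂ | IsLarge B} :=
  (isOpen_lt continuous_const Complex.continuous_re).inter
    (isOpen_lt ((continuous_const.mul continuous_norm).mul
      (Real.continuous_exp.comp Complex.continuous_re.neg)) continuous_const)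

lemma IsLarge.exp_le {B : ℂ} (h : IsLarge B) : Real.exp (-B.re) ≤ 1 / 32 := by
  have h1 : 1 ≤ ‖B‖ := h.1.le.trans (Complex.re_le_norm B)
  nlinarith [h.2, Real.exp_pos (-B.re)]

/-- Banach's fixed point theorem on the half-plane `re y ≥ re B / 2`. The `32` in `IsLarge` makes
the Lipschitz constant at most `1 / 2` and puts the image within `1 / 8` of `B`, inside the
half-plane because `re B > 1`. -/
lemma exists_isExpRoot (b : Bool) {B : ℂ} (h : IsLarge B) :
    ∃ y : ℂ, B.re / 2 ≤ y.re ∧ IsExpRoot b B y := by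
  have hexp := h.exp_le
  have hB := h.2
  have e : -2 * (B.re / 2) = -B.re := by ring
  have hρ : Real.exp (-2 * (B.re / 2)) ≤ 1 / 2 := by rw [e]; linarith
  set S : Set ℂ := {y | B.re / 2 ≤ y.re} with hS
  have hmaps : Set.MapsTo (expRootMap b B) S S := by
    intro y hy
    have h1 := norm_expRootMap_sub_self_le (b := b) (B := B) hρ hy
    have h2 := (abs_le.1 ((Complex.abs_re_le_norm _).trans h1)).1
    rw [Complex.sub_re, e] at h2
    change B.re / 2 ≤ _
    linarith [h.1]
  have hc : ContractingWith (1 / 2) (hmaps.restrict (expRootMap b B) S S) := by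
    refine ⟨by rw [← NNReal.coe_lt_coe]; norm_num, LipschitzWith.of_dist_le_mul fun y₁ y₂ => ?_⟩
    have h1 := norm_expRootMap_sub_le (b := b) (B := B) hρ y₁.2 y₂.2
    rw [Subtype.dist_eq, Subtype.dist_eq, dist_eq_norm, dist_eq_norm]
    refine h1.trans ?_
    rw [e]
    gcongr
    push_cast
    linarith
  obtain ⟨y, hy, hfix, -⟩ := hc.exists_fixedPoint'
    (isClosed_le continuous_const Complex.continuous_re).isComplete hmaps (x := B)
    (by change B.re / 2 ≤ B.re; linarith [h.1]) (edist_ne_top _ _)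
  exact ⟨y, hy, (isExpRoot_iff ((norm_exp_le_of_re_ge hy).trans hρ)).2 hfix⟩

open Classical in
/-- The root `y` near `B` of the characteristic equation. -/
def bigRoot (b : Bool) (B : ℂ) : ℂ :=
  if h : IsLarge B then (exists_isExpRoot b h).choose else 0

lemma re_bigRoot_ge (b : Bool) {B : ℂ} (h : IsLarge B) : B.re / 2 ≤ (bigRoot b B).re := by
  rw [bigRoot, dif_pos h]; exact (exists_isExpRoot b h).choose_spec.1

lemma isExpRoot_bigRoot (b : Bool) {B : ℂ} (h : IsLarge B) : IsExpRoot b B (bigRoot b B) := by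
  rw [bigRoot, dif_pos h]; exact (exists_isExpRoot b h).choose_spec.2

lemma IsLarge.exp_half_le {B : ℂ} (h : IsLarge B) : Real.exp (-2 * (B.re / 2)) ≤ 1 / 2 := by
  have := h.exp_le
  rw [show -2 * (B.re / 2) = -B.re by ring]; linarith

lemma norm_bigRoot_sub_le (b : Bool) {B : ℂ} (h : IsLarge B) : ‖bigRoot b B - B‖ ≤ 1 / 4 := by
  have h1 := norm_expRootMap_sub_self_le (b := b) (B := B) h.exp_half_le (re_bigRoot_ge b h)
  rw [(isExpRoot_iff ((norm_exp_le_of_re_ge (re_bigRoot_ge b h)).trans h.exp_half_le)).1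
    (isExpRoot_bigRoot b h), show -2 * (B.re / 2) = -B.re by ring] at h1
  linarith [h.2]

lemma eq_bigRoot {b : Bool} {B y : ℂ} (h : IsLarge B) (hy : B.re / 2 ≤ y.re)
    (hr : IsExpRoot b B y) : y = bigRoot b B := by
  refine IsExpRoot.unique h.exp_half_le ?_ hy (re_bigRoot_ge b h) hr (isExpRoot_bigRoot b h)
  rw [show -2 * (B.re / 2) = -B.re by ring]
  have := h.2
  have h2 : 0 ≤ ‖B‖ * Real.exp (-B.re) := by positivity
  linarith

lemma exists_analyticAt_rightInverse {f : ℂ → ℂ} {x f' : ℂ} (hf : AnalyticAt ℂ f x)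
    (hd : HasDerivAt f f' x) (hf' : f' ≠ 0) :
    ∃ g : ℂ → ℂ, AnalyticAt ℂ g (f x) ∧ g (f x) = x ∧ ∀ᶠ w in 𝓝 (f x), f (g w) = w := by
  have hd' : deriv f x ≠ 0 := by rwa [hd.deriv]
  exact ⟨_, hf.analyticAt_localInverse hd', HasStrictFDerivAt.localInverse_apply_image ..,
    HasStrictDerivAt.eventually_right_inverse ..⟩

/-- The equation can be solved for `B` as an analytic function of `y`. Its local inverse yields
roots in the half-plane of uniqueness, so it coincides with `bigRoot`, although that is chosen
separately for each parameter. -/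
lemma analyticAt_bigRoot (b : Bool) {B : ℂ} (h : IsLarge B) : AnalyticAt ℂ (bigRoot b) B := by
  set y := bigRoot b B with hy
  set q := paritySign b with hq
  set s := Complex.exp (-2 * y) with hs
  have q1 := norm_paritySign b
  have hre := re_bigRoot_ge b h
  have hroot := isExpRoot_bigRoot b h
  have hexp := h.exp_le
  have hs1 : ‖s‖ ≤ Real.exp (-B.re) := by
    have := norm_exp_le_of_re_ge hre
    rwa [show -2 * (B.re / 2) = -B.re by ring] at this
  have n1 := half_le_norm_one_add q1 (hs1.trans (by linarith))
  have n2 := half_le_norm_one_sub q1 (hs1.trans (by linarith))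
  have z1 : 1 + q * s ≠ 0 := norm_pos_iff.1 (by linarith)
  have hB1 : 1 ≤ ‖B‖ := h.1.le.trans (Complex.re_le_norm B)
  have hclose := norm_bigRoot_sub_le b h
  have hyB : ‖y + B‖ ≤ 3 * ‖B‖ := by
    calc ‖y + B‖ = ‖(y - B) + 2 * B‖ := by congr 1; ring
      _ ≤ ‖y - B‖ + ‖2 * B‖ := norm_add_le _ _
      _ ≤ 1 / 4 + 2 * ‖B‖ := by rw [norm_mul]; simp only [Complex.norm_ofNat]; gcongr
      _ ≤ _ := by linarith
  -- Up to the factor `1 + q * s` this is the derivative of `B` with respect to `y`, simplified by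
  -- the root equation. The second term is at most `6 / 32`, the first at least `1 / 2`.
  have hne : (1 - q * s + 2 * q * s * (y + B)) ≠ 0 := by
    have h3 : ‖2 * q * s * (y + B)‖ ≤ 6 / 32 := by
      rw [norm_mul, norm_mul, norm_mul, q1, mul_one, Complex.norm_ofNat]
      have := h.2
      calc 2 * ‖s‖ * ‖y + B‖ ≤ 2 * Real.exp (-B.re) * (3 * ‖B‖) := by gcongr
        _ ≤ _ := by linarith
    have h4 := norm_sub_norm_le (1 - q * s) (-(2 * q * s * (y + B)))
    rw [norm_neg, sub_neg_eq_add] at h4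
    exact norm_pos_iff.1 (by linarith)
  set f : ℂ → ℂ := fun y => y * (1 - q * Complex.exp (-2 * y)) / (1 + q * Complex.exp (-2 * y))
    with hf
  have hfy : f y = B := by
    rw [hf, div_eq_iff z1]; exact hroot
  have hE : HasDerivAt (fun y => q * Complex.exp (-2 * y)) (q * (s * (-2))) y := by
    have : HasDerivAt (fun y => Complex.exp (-2 * y)) (Complex.exp (-2 * y) * (-2)) y := by
      simpa using ((hasDerivAt_id y).const_mul (-2 : ℂ)).cexp
    exact this.const_mul q
  have hd : HasDerivAt f ((1 - q * s + 2 * q * s * (y + B)) / (1 + q * s)) y := by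
    refine (((hasDerivAt_id y).mul (hE.const_sub 1)).div (hE.const_add 1) z1).congr_deriv ?_
    have hr : y * (1 - q * s) = B * (1 + q * s) := hroot
    simp only [id, Pi.mul_apply]
    rw [div_eq_div_iff (pow_ne_zero 2 z1) z1]
    linear_combination (2 * q * s * (1 + q * s)) * hr
  have han : AnalyticAt ℂ f y := by
    refine AnalyticAt.div ?_ ?_ z1 <;> fun_prop
  obtain ⟨g, hg, hgB, hfg⟩ := exists_analyticAt_rightInverse han hd (div_ne_zero hne z1)
  rw [hfy] at hg hgB hfg
  refine hg.congr ?_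
  have c1 : ∀ᶠ w in 𝓝 B, w.re / 2 < (g w).re := by
    refine ContinuousAt.eventually_lt (by fun_prop)
      (Complex.continuous_re.continuousAt.comp hg.continuousAt) ?_
    simp only [hgB]
    have := (abs_le.1 ((Complex.abs_re_le_norm _).trans hclose)).1
    rw [Complex.sub_re] at this
    change B.re / 2 < (bigRoot b B).re
    linarith [h.1]
  filter_upwards [hfg, c1, isOpen_setOf_isLarge.mem_nhds h] with w h1 h2 h3
  refine eq_bigRoot h3 h2.le ?_
  have hs2 : ‖Complex.exp (-2 * g w)‖ ≤ 1 / 2 := (norm_exp_le_of_re_ge h2.le).trans h3.exp_half_le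
  have n3 := half_le_norm_one_add q1 hs2
  have z3 : 1 + q * Complex.exp (-2 * g w) ≠ 0 := norm_pos_iff.1 (by linarith)
  exact (div_eq_iff z3).1 h1

/-! ### Bounded roots of the characteristic function -/

/-- With `w = 1 / A` the even equation reads `cos z / (z * sin z) = w`, which is regular at `A = ∞`.
The left side has a simple zero at `(n + 1 / 2) π`, so the inverse function theorem applies at `w =
0`. -/
lemma exists_analytic_bounded_root (n : ℕ) :
    ∃ g : ℂ → ℂ, AnalyticAt ℂ g 0 ∧ g 0 = (((n + 1 / 2 : ℝ) * Real.pi : ℝ) : ℂ) ∧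
      ∀ᶠ w in 𝓝 (0 : ℂ), ∀ A, A * w = 1 → charFn false A (g w) = 0 := by
  set r : ℝ := (n + 1 / 2 : ℝ) * Real.pi with hr
  have hr0 : (r : ℂ) ≠ 0 := by
    have : 0 < r := by positivity
    exact_mod_cast this.ne'
  have hc : Complex.cos r = 0 := by
    rw [← Complex.ofReal_cos, hr, show ((n : ℝ) + 1 / 2) * Real.pi = n * Real.pi + Real.pi / 2 by ring,
      Real.cos_add_pi_div_two, Real.sin_nat_mul_pi]
    simp
  have hs : Complex.sin r ≠ 0 := by
    intro h
    have := Complex.sin_sq_add_cos_sq (r : ℂ)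
    rw [h, hc] at this
    simp at this
  have hden : (r : ℂ) * Complex.sin r ≠ 0 := mul_ne_zero hr0 hs
  set f : ℂ → ℂ := fun z => Complex.cos z / (z * Complex.sin z) with hf
  have hfr : f r = 0 := by simp [hf, hc]
  have han : AnalyticAt ℂ f r := by
    refine AnalyticAt.div ?_ ?_ hden <;> fun_prop
  have hd : HasDerivAt f (-(1 / (r : ℂ))) r := by
    refine ((Complex.hasDerivAt_cos _).div ((hasDerivAt_id _).mul (Complex.hasDerivAt_sin _))
      hden).congr_deriv ?_
    simp only [Pi.mul_apply, hc]
    field_simp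
    ring
  obtain ⟨g, hg, hg0, hfg⟩ := exists_analyticAt_rightInverse han hd
    (neg_ne_zero.2 (one_div_ne_zero hr0))
  rw [hfr] at hg hg0 hfg
  refine ⟨g, hg, hg0, ?_⟩
  have hcont : ContinuousAt (fun w => g w * Complex.sin (g w)) 0 :=
    hg.continuousAt.mul (Complex.continuous_sin.continuousAt.comp hg.continuousAt)
  filter_upwards [hfg, hcont.eventually_ne (by rwa [hg0])] with w h1 h2 A hA
  rw [hf, div_eq_iff h2] at h1
  simp only [charFn, phase, Bool.false_eq_true, if_false, sub_zero]
  linear_combination -A * h1 - g w * Complex.sin (g w) * hA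

/-! ### The limit in the sector -/

lemma tendsto_norm_sectorAtInfty (φ : ℝ) : Tendsto norm (sectorAtInfty φ) atTop :=
  tendsto_norm_cobounded_atTop.mono_left inf_le_left

lemma eventually_cos_mul_norm_le {φ : ℝ} (hφ : φ < Real.pi / 2) :
    ∀ᶠ α in sectorAtInfty φ, Real.cos φ * ‖α‖ ≤ (-α).re := by
  have h : ∀ᶠ α in sectorAtInfty φ, α ∈ sectorNeg φ :=
    mem_inf_of_right (mem_principal_self _)
  filter_upwards [h] with α hα
  have h1 := Complex.norm_mul_cos_arg (-α)
  rw [← h1, norm_neg, mul_comm, ← Real.cos_abs (Complex.arg (-α))]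
  gcongr
  exact Real.cos_le_cos_of_nonneg_of_le_pi (abs_nonneg _) (by linarith [Real.pi_pos]) hα.2.le

lemma eventually_mul_exp_lt {φ c : ℝ} (hc : 0 < c) (K : ℝ) :
    ∀ᶠ α in sectorAtInfty φ, K * ‖α‖ * Real.exp (-(c * ‖α‖)) < 1 := by
  have h := ((tendsto_rpow_mul_exp_neg_mul_atTop_nhds_zero 1 c hc).const_mul K).comp
    (tendsto_norm_sectorAtInfty φ)
  rw [mul_zero] at h
  filter_upwards [h.eventually (gt_mem_nhds one_pos)] with α hα
  simp only [Function.comp, Real.rpow_one] at hα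
  rw [neg_mul] at hα
  linarith

lemma eventually_isLarge {φ l : ℝ} (hφ₀ : 0 < φ) (hφ : φ < Real.pi / 2) (hl : 0 < l) :
    ∀ᶠ α in sectorAtInfty φ, IsLarge (-(α * l)) := by
  have hc : 0 < Real.cos φ := Real.cos_pos_of_mem_Ioo ⟨by linarith, hφ⟩
  have hlc : 0 < l * Real.cos φ := mul_pos hl hc
  filter_upwards [eventually_cos_mul_norm_le hφ, eventually_mul_exp_lt hlc (32 * l),
    (tendsto_norm_sectorAtInfty φ).eventually_gt_atTop (1 / (l * Real.cos φ))] with α h1 h2 h3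
  have e : (-(α * l)).re = l * (-α).re := by simp [mul_comm]
  have h4 : l * Real.cos φ * ‖α‖ ≤ l * (-α).re := by rw [mul_assoc]; gcongr
  refine ⟨?_, ?_⟩
  · rw [div_lt_iff₀ hlc] at h3
    rw [e]
    linarith
  · rw [norm_neg, norm_mul, Complex.norm_real, Real.norm_eq_abs, abs_of_pos hl, e]
    refine lt_of_le_of_lt ?_ h2
    rw [show 32 * (‖α‖ * l) = 32 * l * ‖α‖ by ring]
    gcongr

/-- This provides the hypothesis of `deriv_charFn_ne_zero`: in the sector `|re α|` is at least a
fixed multiple of `|α|`, so its square dominates. -/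
lemma eventually_two_mul_norm_lt {φ l : ℝ} (hφ₀ : 0 < φ) (hφ : φ < Real.pi / 2) (hl : 0 < l) :
    ∀ᶠ α in sectorAtInfty φ, 2 * ‖α * (l : ℂ)‖ < (α * (l : ℂ)).re ^ 2 := by
  have hc : 0 < Real.cos φ := Real.cos_pos_of_mem_Ioo ⟨by linarith, hφ⟩
  filter_upwards [eventually_cos_mul_norm_le hφ,
    (tendsto_norm_sectorAtInfty φ).eventually_gt_atTop (2 / (l * Real.cos φ ^ 2)),
    (tendsto_norm_sectorAtInfty φ).eventually_gt_atTop 0] with α h1 h2 h3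
  rw [div_lt_iff₀ (by positivity)] at h2
  rw [norm_mul, Complex.norm_real, Real.norm_eq_abs, abs_of_pos hl, Complex.re_mul_ofReal, mul_pow]
  have h4 : (Real.cos φ * ‖α‖) ^ 2 ≤ α.re ^ 2 := by
    rw [← neg_sq α.re, ← Complex.neg_re]
    gcongr
  calc 2 * (‖α‖ * l) < ‖α‖ * (l * Real.cos φ ^ 2) * (‖α‖ * l) := by gcongr
    _ = (Real.cos φ * ‖α‖) ^ 2 * l ^ 2 := by ring
    _ ≤ _ := by gcongr

/-- Every root in a coordinate is the large one, or it has a small imaginary part. -/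
lemma eventually_root_dichotomy {φ l δ : ℝ} (hφ₀ : 0 < φ) (hφ : φ < Real.pi / 2) (hl : 0 < l)
    (hδ : 0 < δ) (hδ' : δ ≤ Real.cos φ / 2) :
    ∀ᶠ α in sectorAtInfty φ, ∀ b κ, charFn b (α * l) (κ * l) = 0 →
      ∃ k : ℂ, (κ = Complex.I * k ∨ κ = -(Complex.I * k)) ∧ 0 ≤ k.re ∧
        (k = bigRoot b (-(α * l)) / l ∨ k.re ≤ δ * ‖α‖) := by
  have hl' : (l : ℂ) ≠ 0 := by exact_mod_cast hl.ne'
  filter_upwards [eventually_isLarge hφ₀ hφ hl, eventually_cos_mul_norm_le hφ,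
    eventually_mul_exp_lt (c := 2 * (δ * l)) (by positivity) (16 * l),
    (tendsto_norm_sectorAtInfty φ).eventually_ge_atTop (1 / l)] with α hL hcos hexp hge b κ hκ
  have hαl : 1 ≤ l * ‖α‖ := by rwa [div_le_iff₀' hl] at hge
  have main : ∀ k : ℂ, charFn b (α * l) (Complex.I * (k * l)) = 0 →
      (k = bigRoot b (-(α * l)) / l ∨ k.re ≤ δ * ‖α‖) := by
    intro k hk
    rw [or_iff_not_imp_right, not_le]
    intro hre
    rw [← neg_neg (α * (l : ℂ)), charFn_I_mul_eq_zero_iff] at hk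
    rw [eq_div_iff hl']
    have e : Real.exp (-2 * (δ * l * ‖α‖)) = Real.exp (-(2 * (δ * l) * ‖α‖)) := by
      congr 1; ring
    have hB : ‖-(α * (l : ℂ))‖ = l * ‖α‖ := by
      rw [norm_neg, norm_mul, Complex.norm_real, Real.norm_eq_abs, abs_of_pos hl, mul_comm]
    -- Uniqueness already holds for `re y ≥ δ l |α|`, since `|α| exp (-2 δ l |α|)` tends to zero; `δ
    -- ≤ cos φ / 2` places the large root there as well.
    refine IsExpRoot.unique (b := b) (B := -(α * l)) (ρ := δ * l * ‖α‖) ?_ ?_ ?_ ?_ hk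
      (isExpRoot_bigRoot b hL)
    · rw [e]
      nlinarith [Real.exp_pos (-(2 * (δ * l) * ‖α‖))]
    · rw [e, hB]; linarith
    · rw [Complex.re_mul_ofReal]; nlinarith
    · refine le_trans ?_ (re_bigRoot_ge b hL)
      have e2 : (-(α * (l : ℂ))).re = l * (-α).re := by simp [mul_comm]
      rw [e2]
      have : δ * ‖α‖ ≤ (-α).re / 2 := by nlinarith [norm_nonneg α]
      nlinarith
  -- Roots come in pairs `±κ`, so `k` may be taken in the right half-plane.
  rcases le_total 0 (-(Complex.I * κ)).re with h | h
  · refine ⟨-(Complex.I * κ), Or.inl ?_, h, main _ ?_⟩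
    · linear_combination κ * Complex.I_sq
    · rw [← hκ]; congr 1; linear_combination (-κ * l) * Complex.I_sq
  · refine ⟨Complex.I * κ, Or.inr ?_, by simpa using h, main _ ?_⟩
    · linear_combination κ * Complex.I_sq
    · have e : Complex.I * (Complex.I * κ * l) = -(κ * l) := by
        linear_combination (κ * l) * Complex.I_sq
      rw [e, charFn_neg, hκ, mul_zero]

/-- The large frequencies. -/
def bigFreq {d : ℕ} (a : Fin d → ℝ) (α : ℂ) (b : Fin d → Bool) (i : Fin d) : ℂ :=
  Complex.I * (bigRoot (b i) (-(α * a i)) / a i)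

lemma norm_bigRoot_div_add_le {l : ℝ} (hl : 0 < l) {α : ℂ} (h : IsLarge (-(α * l))) (b : Bool) :
    ‖bigRoot b (-(α * l)) / l + α‖ ≤ 1 / (4 * l) := by
  have hl' : (l : ℂ) ≠ 0 := by exact_mod_cast hl.ne'
  have e : bigRoot b (-(α * l)) / l + α = (bigRoot b (-(α * l)) - -(α * l)) / l := by
    field_simp
    ring
  rw [e, norm_div, Complex.norm_real, Real.norm_eq_abs, abs_of_pos hl, div_le_div_iff₀ hl
    (by positivity)]
  have := norm_bigRoot_sub_le b h
  nlinarith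

/-! ### Frequencies of the eigenvalues near `-d α ^ 2`. -/

lemma norm_sq_sub_sq_le {k β : ℂ} {δ r : ℝ} (hr : ‖β‖ ≤ r) (hδ0 : 0 ≤ δ) (hδ : δ ≤ 1)
    (h : ‖k - β‖ ≤ δ * r) : ‖k ^ 2 - β ^ 2‖ ≤ 3 * δ * r ^ 2 := by
  have hr0 := (norm_nonneg β).trans hr
  have e : k ^ 2 - β ^ 2 = (k - β) * ((k - β) + 2 * β) := by ring
  rw [e, norm_mul]
  have h2 : ‖(k - β) + 2 * β‖ ≤ 3 * r := by
    refine (norm_add_le _ _).trans ?_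
    rw [norm_mul, Complex.norm_ofNat]
    nlinarith
  calc ‖k - β‖ * ‖(k - β) + 2 * β‖ ≤ δ * r * (3 * r) := by gcongr
    _ = _ := by ring

/-- If the sum of the squares is close to `d β ^ 2`, then none of the summands has a small real
part. -/
lemma close_of_sum_sq {d : ℕ} {β : ℂ} {c δ : ℝ} (hc : 0 < c) (hc1 : c ≤ 1)
    (hδ : δ = c / (4 * (1 + 3 * d))) (hβ : β ≠ 0) (hβc : c * ‖β‖ ≤ β.re) {k : Fin d → ℂ}
    {P : Fin d → Prop} (hk0 : ∀ i, 0 ≤ (k i).re)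
    (hk : ∀ i, (P i ∧ ‖k i - β‖ ≤ δ * ‖β‖) ∨ (k i).re ≤ δ * ‖β‖)
    (hs : ‖∑ i, k i ^ 2 - d * β ^ 2‖ ≤ δ * ‖β‖ ^ 2) (i : Fin d) : P i := by
  set r := ‖β‖ with hr
  have hr0 : 0 < r := norm_pos_iff.2 hβ
  have hδ0 : 0 < δ := by rw [hδ]; positivity
  have hδeq : δ * (1 + 3 * d) = c / 4 := by rw [hδ]; field_simp
  have hd0 : (0 : ℝ) ≤ d := Nat.cast_nonneg d
  have hδc : δ ≤ c / 4 := by nlinarith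
  have hδ1 : δ ≤ 1 := by linarith
  have hn : r ^ 2 = β.re ^ 2 + β.im ^ 2 := by
    rw [hr, ← Complex.normSq_eq_norm_sq, Complex.normSq_apply]; ring
  -- A frequency with small real part may still have a huge square, but almost in the direction of
  -- the negative axis. The functional `L` detects this: it is at least `c r ^ 3` at `β ^ 2`, while
  -- the square of such a frequency can exceed zero only by little.
  set L : ℂ → ℝ := fun w => (w * (starRingEnd ℂ) β).re with hL
  have hLb : ∀ w, |L w| ≤ ‖w‖ * r := fun w => by
    refine (Complex.abs_re_le_norm _).trans ?_
    rw [norm_mul, RCLike.norm_conj]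
  have hLβ : L (β ^ 2) = r ^ 2 * β.re := by
    rw [hn]; simp only [hL, pow_two, Complex.mul_re, Complex.mul_im, Complex.conj_re,
      Complex.conj_im]; ring
  have hbig : ∀ i, P i ∧ ‖k i - β‖ ≤ δ * r → L (k i ^ 2 - β ^ 2) ≤ 3 * δ * r ^ 3 := by
    intro i hi
    have h1 := norm_sq_sub_sq_le (r := r) le_rfl hδ0.le hδ1 hi.2
    calc L (k i ^ 2 - β ^ 2) ≤ ‖k i ^ 2 - β ^ 2‖ * r := (abs_le.1 (hLb _)).2
      _ ≤ 3 * δ * r ^ 2 * r := by gcongr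
      _ = _ := by ring
  have hsmall : ∀ i, (k i).re ≤ δ * r → L (k i ^ 2 - β ^ 2) ≤ -(c / 2) * r ^ 3 := by
    intro i hi
    have e : L (k i ^ 2 - β ^ 2) = ((k i).re ^ 2 - (k i).im ^ 2) * β.re +
        2 * (k i).re * (k i).im * β.im - r ^ 2 * β.re := by
      rw [← hLβ]
      simp only [hL, pow_two, Complex.mul_re, Complex.mul_im, Complex.conj_re,
        Complex.conj_im, Complex.sub_re, Complex.sub_im]
      ring
    rw [e]
    set s := (k i).re
    set t := (k i).im
    have hs0 : 0 ≤ s := hk0 i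
    have hre : β.re ≤ r := Complex.re_le_norm β
    have him : |β.im| ≤ r := Complex.abs_im_le_norm β
    have hs2 : s ^ 2 ≤ (δ * r) ^ 2 := by gcongr
    have h1 : 2 * s * t * β.im ≤ 2 * s * |t| * r := by
      calc 2 * s * t * β.im ≤ |2 * s * t * β.im| := le_abs_self _
        _ = 2 * s * |t| * |β.im| := by
          rw [abs_mul, abs_mul, abs_of_nonneg (by positivity : 0 ≤ 2 * s)]
        _ ≤ _ := by gcongr
    -- The weight is chosen so that `c * t ^ 2` is absorbed by the term `-t ^ 2 * (c * r)`, whatever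
    -- the size of `t`.
    have h2 : 2 * s * |t| ≤ s ^ 2 / c + c * t ^ 2 := by
      have h3 : 0 ≤ (s - c * |t|) ^ 2 / c := by positivity
      have h4 : (s - c * |t|) ^ 2 / c = s ^ 2 / c + c * t ^ 2 - 2 * s * |t| := by
        rw [← sq_abs t]; field_simp; ring
      linarith
    have h3 : (s ^ 2 - t ^ 2) * β.re ≤ s ^ 2 * r - t ^ 2 * (c * r) := by
      nlinarith [sq_nonneg s, sq_nonneg t]
    have h4 : s ^ 2 / c ≤ c / 16 * r ^ 2 := by
      rw [div_le_iff₀ hc]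
      calc s ^ 2 ≤ (δ * r) ^ 2 := hs2
        _ ≤ (c / 4 * r) ^ 2 := by gcongr
        _ = _ := by ring
    have h5 : s ^ 2 ≤ c / 16 * r ^ 2 := by
      calc s ^ 2 ≤ s ^ 2 / c := by rw [le_div_iff₀ hc]; nlinarith [sq_nonneg s]
        _ ≤ _ := h4
    have h6 : 2 * s * |t| * r ≤ (s ^ 2 / c + c * t ^ 2) * r := by gcongr
    have h7 : r ^ 2 * (c * r) ≤ r ^ 2 * β.re := by gcongr
    have h8 : s ^ 2 / c * r ≤ c / 16 * r ^ 2 * r := by gcongr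
    have h9 : s ^ 2 * r ≤ c / 16 * r ^ 2 * r := by gcongr
    have h10 : 0 < c * r ^ 3 := by positivity
    nlinarith
  by_contra hi
  have hi' : (k i).re ≤ δ * r := (hk i).resolve_left fun h => hi h.1
  have hall : ∀ j, L (k j ^ 2 - β ^ 2) ≤ 3 * δ * r ^ 3 := fun j => (hk j).elim (hbig j) fun h =>
    (hsmall j h).trans (by
      have h1 : 0 ≤ c * r ^ 3 := by positivity
      have h2 : 0 ≤ δ * r ^ 3 := by positivity
      linarith)
  have hLsum : L (∑ j, k j ^ 2 - d * β ^ 2) = ∑ j, L (k j ^ 2 - β ^ 2) := by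
    have e : ∑ j, k j ^ 2 - d * β ^ 2 = ∑ j, (k j ^ 2 - β ^ 2) := by
      rw [Finset.sum_sub_distrib]; simp
    rw [e]
    simp only [hL, Finset.sum_mul, Complex.re_sum]
  -- One small frequency costs `c / 2`, which the others cannot make up: `δ` satisfies `δ + 3 d δ =
  -- c / 4`.
  have hup : ∑ j, L (k j ^ 2 - β ^ 2) ≤ -(c / 2) * r ^ 3 + d * (3 * δ * r ^ 3) := by
    rw [← Finset.add_sum_erase _ _ (Finset.mem_univ i)]
    refine add_le_add (hsmall i hi') ?_
    refine (Finset.sum_le_card_nsmul _ _ _ fun j _ => hall j).trans ?_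
    rw [nsmul_eq_mul]
    gcongr
    exact (Nat.cast_le.2 (Finset.card_erase_le (s := Finset.univ) (a := i))).trans_eq (by simp)
  have hlow : -(δ * r ^ 3) ≤ L (∑ j, k j ^ 2 - d * β ^ 2) := by
    have h1 := (abs_le.1 (hLb (∑ j, k j ^ 2 - d * β ^ 2))).1
    have h2 : ‖∑ j, k j ^ 2 - d * β ^ 2‖ * r ≤ δ * r ^ 2 * r := by gcongr
    have h3 : δ * r ^ 2 * r = δ * r ^ 3 := by ring
    linarith
  rw [hLsum] at hlow
  have h1 : 0 < c * r ^ 3 := by positivity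
  have h2 : δ * r ^ 3 * (1 + 3 * d) = c * r ^ 3 / 4 := by
    calc δ * r ^ 3 * (1 + 3 * d) = δ * (1 + 3 * d) * r ^ 3 := by ring
      _ = _ := by rw [hδeq]; ring
  nlinarith

/-- The tolerance in the separation of the eigenvalues near `-d α ^ 2` from the others. -/
def tolerance (d : ℕ) (φ : ℝ) : ℝ := Real.cos φ / (4 * (1 + 3 * d))

lemma tolerance_pos {d : ℕ} {φ : ℝ} (hφ₀ : 0 < φ) (hφ : φ < Real.pi / 2) : 0 < tolerance d φ := by
  have hc : 0 < Real.cos φ := Real.cos_pos_of_mem_Ioo ⟨by linarith, hφ⟩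
  unfold tolerance
  positivity

/-- Near `-d α ^ 2` all the frequencies are large. -/
lemma eventually_eq_bigFreq {d : ℕ} {a : Fin d → ℝ} (ha : ∀ i, 0 < a i) {φ : ℝ} (hφ₀ : 0 < φ)
    (hφ : φ < Real.pi / 2) :
    ∀ᶠ α in sectorAtInfty φ, ∀ κ b, IsRoot a α κ b →
      ‖∑ i, κ i ^ 2 + d * α ^ 2‖ ≤ tolerance d φ * ‖α‖ ^ 2 →
      ∀ i, κ i = bigFreq a α b i ∨ κ i = -bigFreq a α b i := by
  have hc : 0 < Real.cos φ := Real.cos_pos_of_mem_Ioo ⟨by linarith, hφ⟩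
  have hδ := tolerance_pos (d := d) hφ₀ hφ
  have hδ2 : tolerance d φ ≤ Real.cos φ / 2 := by
    unfold tolerance
    gcongr
    have : (0 : ℝ) ≤ d := Nat.cast_nonneg d
    linarith
  filter_upwards [eventually_all.2 fun i => eventually_root_dichotomy hφ₀ hφ (ha i) hδ hδ2,
    eventually_all.2 fun i => eventually_isLarge hφ₀ hφ (ha i), eventually_cos_mul_norm_le hφ,
    eventually_all.2 fun i => (tendsto_norm_sectorAtInfty φ).eventually_ge_atTop
      (1 / (4 * a i) / tolerance d φ), (tendsto_norm_sectorAtInfty φ).eventually_gt_atTop 0]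
    with α h1 h2 h3 h4 h5 κ b hκ hs
  choose k hk hk0 hkd using fun i => h1 i (b i) (κ i) (hκ i)
  have hsq : ∀ i, κ i ^ 2 = -(k i ^ 2) := fun i => by
    have : (Complex.I * k i) ^ 2 = -(k i ^ 2) := by
      linear_combination (k i ^ 2) * Complex.I_sq
    rcases hk i with h | h
    · rw [h, this]
    · rw [h, neg_sq, this]
  have key := close_of_sum_sq (β := -α) (k := k)
    (P := fun i => k i = bigRoot (b i) (-(α * a i)) / a i) hc
    (Real.cos_le_one φ) rfl (neg_ne_zero.2 (norm_pos_iff.1 h5)) (by rwa [norm_neg]) hk0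
    (fun i => by
      rw [norm_neg]
      refine (hkd i).imp (fun h => ⟨h, ?_⟩) id
      rw [h, sub_neg_eq_add]
      refine (norm_bigRoot_div_add_le (ha i) (h2 i) (b i)).trans ?_
      have := h4 i
      rw [div_le_iff₀ hδ] at this
      unfold tolerance at this
      linarith)
    (by
      rw [norm_neg, ← norm_neg]
      refine le_of_eq_of_le (congrArg norm ?_) hs
      simp only [hsq, Finset.sum_neg_distrib]
      ring)
  intro i
  rw [bigFreq, ← key i]
  exact hk i

/-! ### Eigencurves -/

lemma modeLp_ne_zero {d : ℕ} {a : Fin d → ℝ} {κ : Fin d → ℂ} {b : Fin d → Bool} {x : Fin d → ℝ}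
    (hx : x ∈ box a) (h : modeProd κ b x ≠ 0) : modeLp a κ b ≠ 0 := by
  intro h0
  have h1 : modeProd κ b =ᵐ[volume.restrict (box a)] fun _ => 0 :=
    (coeFn_modeLp a κ b).symm.trans ((Lp.eq_zero_iff_ae_eq_zero).1 h0)
  have hopen : IsOpen (box a) := isOpen_set_pi Set.finite_univ fun _ _ => isOpen_Ioo
  exact h (Measure.eqOn_open_of_ae_eq h1 hopen (contDiff_modeProd κ b).continuous.continuousOn
    continuousOn_const hx)

lemma isRobinEigenvalue_of_isRoot {d : ℕ} {a : Fin d → ℝ} (ha : ∀ i, 0 < a i) {α : ℂ}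
    {κ : Fin d → ℂ} {b : Fin d → Bool} (hκ : IsRoot a α κ b) {x : Fin d → ℝ}
    (hx : x ∈ box a) (h : modeProd κ b x ≠ 0) : IsRobinEigenvalue a α (∑ i, κ i ^ 2) :=
  ⟨modeLp a κ b, modeLp_ne_zero hx h, modeLp_mem_robinLaplacian ha hκ⟩

/-- Every eigenvalue comes from a mode. -/
lemma exists_isRoot_of_isRobinEigenvalue {d : ℕ} {a : Fin d → ℝ} (ha : ∀ i, 0 < a i) {α μ : ℂ}
    (hα : ∀ i, 2 * ‖α * a i‖ < (α * a i).re ^ 2) (h : IsRobinEigenvalue a α μ) :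
    ∃ κ b, IsRoot a α κ b ∧ ∑ i, κ i ^ 2 = μ := by
  obtain ⟨u, hu, hmem⟩ := h
  by_contra! hne
  exact hu (eq_zero_of_inner_modes ha hα fun κ b hκ =>
    inner_eq_zero_of_mem_iSup_kerPow ha hκ (hne κ b hκ) (mem_iSup_kerPow_of_eigen hmem))

lemma isRoot_bigFreq_coordinate {l : ℝ} (hl : 0 < l) {α : ℂ} (h : IsLarge (-(α * l))) (b : Bool) :
    charFn b (α * l) (Complex.I * (bigRoot b (-(α * l)) / l) * l) = 0 := by
  have hl' : (l : ℂ) ≠ 0 := by exact_mod_cast hl.ne'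
  rw [mul_assoc, div_mul_cancel₀ _ hl']
  have := (charFn_I_mul_eq_zero_iff b _ _).2 (isExpRoot_bigRoot b h)
  rwa [neg_neg] at this

lemma analyticAt_bigFreq {d : ℕ} {a : Fin d → ℝ} {α : ℂ} {i : Fin d}
    (h : IsLarge (-(α * a i))) (b : Fin d → Bool) :
    AnalyticAt ℂ (fun α => bigFreq a α b i) α := by
  have h1 : AnalyticAt ℂ (fun α : ℂ => -(α * a i)) α := by fun_prop
  have h2 : AnalyticAt ℂ (fun α : ℂ => bigRoot (b i) (-(α * a i))) α :=
    (analyticAt_bigRoot (b i) h).comp_of_eq h1 rfl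
  exact analyticAt_const.mul (h2.div_const)

lemma bigFreq_sq_add_isLittleO {d : ℕ} {a : Fin d → ℝ} (ha : ∀ i, 0 < a i) {φ : ℝ} (hφ₀ : 0 < φ)
    (hφ : φ < Real.pi / 2) (b : Fin d → Bool) (i : Fin d) :
    (fun α => bigFreq a α b i ^ 2 + α ^ 2) =o[sectorAtInfty φ] fun α => α ^ 2 := by
  rw [isLittleO_iff]
  intro c hc
  set δ := min (c / 3) 1 with hδ
  have hδ0 : 0 < δ := lt_min (by positivity) one_pos
  filter_upwards [eventually_isLarge hφ₀ hφ (ha i),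
    (tendsto_norm_sectorAtInfty φ).eventually_ge_atTop (1 / (4 * a i) / δ)] with α h1 h2
  rw [div_le_iff₀ hδ0] at h2
  have h3 := norm_bigRoot_div_add_le (ha i) h1 (b i)
  have h4 := norm_sq_sub_sq_le (k := bigRoot (b i) (-(α * a i)) / a i) (β := -α) (r := ‖α‖)
    (norm_neg α).le hδ0.le (min_le_right _ _) (by rw [sub_neg_eq_add]; linarith)
  have e : bigFreq a α b i ^ 2 + α ^ 2 =
      -((bigRoot (b i) (-(α * a i)) / a i) ^ 2 - (-α) ^ 2) := by
    rw [bigFreq]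
    linear_combination ((bigRoot (b i) (-(α * a i)) / a i) ^ 2) * Complex.I_sq
  rw [e, norm_neg, norm_pow]
  refine h4.trans ?_
  gcongr
  have := min_le_left (c / 3) 1
  linarith

lemma isEquivalent_of_isLittleO {φ : ℝ} {f : ℂ → ℂ} {c : ℂ} (hc : c ≠ 0)
    (h : (fun α => f α + c * α ^ 2) =o[sectorAtInfty φ] fun α => α ^ 2) :
    f ~[sectorAtInfty φ] fun α => -c * α ^ 2 := by
  refine (h.const_mul_right (neg_ne_zero.2 hc)).congr_left fun α => ?_
  simp only [Pi.sub_apply]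
  ring

/-- The curve of the eigenvalues with large frequencies. -/
def bigCurve {d : ℕ} (a : Fin d → ℝ) (b : Fin d → Bool) (α : ℂ) : ℂ := ∑ i, bigFreq a α b i ^ 2

lemma isRoot_bigFreq {d : ℕ} {a : Fin d → ℝ} (ha : ∀ i, 0 < a i) {α : ℂ}
    (h : ∀ i, IsLarge (-(α * a i))) (b : Fin d → Bool) : IsRoot a α (bigFreq a α b) b :=
  fun i => isRoot_bigFreq_coordinate (ha i) (h i) (b i)

lemma bigCurve_isEquivalent {d : ℕ} (hd : d ≠ 0) {a : Fin d → ℝ} (ha : ∀ i, 0 < a i) {φ : ℝ}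
    (hφ₀ : 0 < φ) (hφ : φ < Real.pi / 2) (b : Fin d → Bool) :
    bigCurve a b ~[sectorAtInfty φ] fun α => -(d : ℂ) * α ^ 2 := by
  refine isEquivalent_of_isLittleO (by exact_mod_cast hd) ?_
  have h := IsLittleO.sum (s := Finset.univ) fun i _ => bigFreq_sq_add_isLittleO ha hφ₀ hφ b i
  refine h.congr_left fun α => ?_
  simp [bigCurve, Finset.sum_add_distrib]

/-- The cosine has only real zeros and the argument is not real. The centre `t = 0` is excluded
because odd modes vanish there; hence the point `a i / 2` below. -/
lemma cos_I_mul_sub_phase_ne_zero {b : Bool} {k : ℂ} (hk : 0 < k.re) {t : ℝ} (ht : t ≠ 0) :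
    Complex.cos (Complex.I * k * t - phase b) ≠ 0 := by
  intro h
  have h1 := normSq_cos (Complex.I * k * t - phase b)
  have him : (Complex.I * k * t - phase b).im = k.re * t := by
    rw [Complex.sub_im, im_phase, sub_zero, Complex.im_mul_ofReal]
    simp
  rw [h, him, norm_zero] at h1
  have h2 : Real.sinh (k.re * t) = 0 := by
    nlinarith [sq_nonneg (Real.cos (Complex.I * k * t - phase b).re),
      sq_nonneg (Real.sinh (k.re * t))]
  exact mul_ne_zero hk.ne' ht (Real.sinh_eq_zero.1 h2)

lemma half_mem_box {d : ℕ} {a : Fin d → ℝ} (ha : ∀ i, 0 < a i) : (fun i => a i / 2) ∈ box a :=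
  fun i _ => ⟨by linarith [ha i], by linarith [ha i]⟩

lemma modeProd_bigFreq_ne_zero {d : ℕ} {a : Fin d → ℝ} (ha : ∀ i, 0 < a i) {α : ℂ}
    (h : ∀ i, IsLarge (-(α * a i))) (b : Fin d → Bool) :
    modeProd (bigFreq a α b) b (fun i => a i / 2) ≠ 0 := by
  refine Finset.prod_ne_zero_iff.2 fun i _ => cos_I_mul_sub_phase_ne_zero ?_ (by have := ha i; positivity)
  rw [Complex.div_ofReal_re]
  have h1 := re_bigRoot_ge (b i) (h i)
  have h2 := (h i).1
  exact div_pos (by linarith) (ha i)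

lemma isEigencurve_bigCurve {d : ℕ} {a : Fin d → ℝ} (ha : ∀ i, 0 < a i) {φ : ℝ}
    (hφ₀ : 0 < φ) (hφ : φ < Real.pi / 2) (b : Fin d → Bool) :
    IsEigencurve a φ (bigCurve a b) := by
  filter_upwards [eventually_all.2 fun i => eventually_isLarge hφ₀ hφ (ha i)] with α hα
  refine ⟨isRobinEigenvalue_of_isRoot ha (isRoot_bigFreq ha hα b) (half_mem_box ha)
    (modeProd_bigFreq_ne_zero ha hα b), ?_⟩
  exact Finset.analyticAt_fun_sum _ fun i _ => (analyticAt_bigFreq (hα i) b).pow 2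

lemma eventually_norm_add_le {d : ℕ} (hd : d ≠ 0) {φ δ : ℝ} (hδ : 0 < δ) {f : ℂ → ℂ}
    (h : f ~[sectorAtInfty φ] fun α => -(d : ℂ) * α ^ 2) :
    ∀ᶠ α in sectorAtInfty φ, ‖f α + d * α ^ 2‖ ≤ δ * ‖α‖ ^ 2 := by
  have hd' : (0 : ℝ) < d := by exact_mod_cast Nat.pos_of_ne_zero hd
  filter_upwards [(IsLittleO.def h (c := δ / d) (by positivity))] with α hα
  simp only [Pi.sub_apply, norm_mul, norm_neg, norm_pow, Complex.norm_natCast, neg_mul,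
    sub_neg_eq_add] at hα
  refine hα.trans (le_of_eq ?_)
  field_simp

/-! ### Multiplicities -/

/-- Changing signs of frequencies only multiplies a mode by `±1`, so each choice of parities
contributes one mode with large frequencies. -/
lemma exists_modeProd_eq_const_mul {d : ℕ} {κ κ' : Fin d → ℂ} (b : Fin d → Bool)
    (h : ∀ i, κ i = κ' i ∨ κ i = -κ' i) : ∃ ε : ℂ, ∀ x, modeProd κ b x = ε * modeProd κ' b x := by
  have h1 : ∀ i, ∃ ε : ℂ, ∀ t : ℝ, Complex.cos (κ i * t - phase (b i)) =
      ε * Complex.cos (κ' i * t - phase (b i)) := fun i => by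
    rcases h i with h | h
    · exact ⟨1, fun t => by rw [h, one_mul]⟩
    · exact ⟨paritySign (b i), fun t => by rw [h, neg_mul, cos_neg_sub_phase]⟩
  choose ε hε using h1
  exact ⟨∏ i, ε i, fun x => by simp only [modeProd, hε, Finset.prod_mul_distrib]⟩

lemma inner_modeLp_eq_zero_of_neg {d : ℕ} {a : Fin d → ℝ} {κ κ' : Fin d → ℂ} {b : Fin d → Bool}
    (h : ∀ i, κ i = κ' i ∨ κ i = -κ' i) {u : L2Box a}
    (hu : inner ℂ (modeLp a (fun i => (starRingEnd ℂ) (κ' i)) b) u = 0) :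
    inner ℂ (modeLp a (fun i => (starRingEnd ℂ) (κ i)) b) u = 0 := by
  have e : ∀ κ : Fin d → ℂ, inner ℂ (modeLp a (fun i => (starRingEnd ℂ) (κ i)) b) u =
      ∫ x, modeProd κ b x * u x ∂(boxMeasure a) := fun κ => by
    rw [inner_eq_integral (coeFn_modeLp a _ b) (EventuallyEq.refl _ (u : _ → ℂ))]
    simp only [conj_modeProd, Complex.conj_conj]
  obtain ⟨ε, hε⟩ := exists_modeProd_eq_const_mul b h
  rw [e] at hu ⊢
  simp only [hε, mul_assoc]
  rw [integral_const_mul, hu, mul_zero]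

lemma integral_Ioo_eq_zero_of_odd {f : ℝ → ℂ} {l : ℝ} (hl : 0 < l) (h : ∀ t, f (-t) = -f t) :
    ∫ t in Set.Ioo (-l) l, f t = 0 := by
  rw [← integral_Ioc_eq_integral_Ioo, ← intervalIntegral.integral_of_le (by linarith)]
  have h1 := intervalIntegral.integral_comp_neg (a := -l) (b := l) f
  simp only [h, neg_neg, intervalIntegral.integral_neg] at h1
  exact self_eq_neg.1 h1.symm

/-- In a coordinate where the parities differ the integrand is odd; the frequencies play no role. -/
lemma inner_modeLp_of_ne {d : ℕ} {a : Fin d → ℝ} (ha : ∀ i, 0 < a i) {κ κ' : Fin d → ℂ}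
    {b b' : Fin d → Bool} (h : b ≠ b') : inner ℂ (modeLp a κ b) (modeLp a κ' b') = 0 := by
  obtain ⟨j, hj⟩ := Function.ne_iff.1 h
  rw [inner_eq_integral (coeFn_modeLp a κ b) (coeFn_modeLp a κ' b')]
  simp only [conj_modeProd]
  simp only [modeProd, ← Finset.prod_mul_distrib]
  rw [boxMeasure_eq_pi, integral_fintype_prod_eq_prod (fun i (t : ℝ) =>
    Complex.cos ((starRingEnd ℂ) (κ i) * t - phase (b i)) * Complex.cos (κ' i * t - phase (b' i)))]
  refine Finset.prod_eq_zero (Finset.mem_univ j) (integral_Ioo_eq_zero_of_odd (ha j) fun t => ?_)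
  have e : ∀ k : ℂ, k * ((-t : ℝ) : ℂ) = -(k * t) := fun k => by push_cast; ring
  rw [e, e, cos_neg_sub_phase, cos_neg_sub_phase]
  have hs : paritySign (b j) * paritySign (b' j) = -1 := by
    cases hb : b j <;> cases hb' : b' j <;> simp_all [paritySign]
  linear_combination (Complex.cos ((starRingEnd ℂ) (κ j) * t - phase (b j)) *
    Complex.cos (κ' j * t - phase (b' j))) * hs

lemma algMultiplicity_eq_card {d : ℕ} {a : Fin d → ℝ} (ha : ∀ i, 0 < a i) {α μ : ℂ}
    (hα : ∀ i, 2 * ‖α * a i‖ < (α * a i).re ^ 2) (hL : ∀ i, IsLarge (-(α * a i)))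
    (hμ : ∀ κ b, IsRoot a α κ b → ∑ i, κ i ^ 2 = μ →
      ∀ i, κ i = bigFreq a α b i ∨ κ i = -bigFreq a α b i) :
    algMultiplicity a α μ = Nat.card {b : Fin d → Bool // bigCurve a b α = μ} := by
  classical
  set S := {b : Fin d → Bool // bigCurve a b α = μ}
  set E : Submodule ℂ (L2Box a) := ⨆ n, kerPow a α μ n with hE
  -- Pairing with the adjoint modes for `μ` bounds the dimension from above: an element of the
  -- kernel is orthogonal to all adjoint modes, hence zero by completeness.
  let T : E →ₗ[ℂ] (S → ℂ) := LinearMap.pi fun s =>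
    (innerₛₗ ℂ (modeLp a (fun i => (starRingEnd ℂ) (bigFreq a α s.1 i)) s.1)).comp E.subtype
  have hT : Function.Injective T := by
    refine (injective_iff_map_eq_zero T).2 fun u hu => Subtype.ext ?_
    refine eq_zero_of_inner_modes ha hα fun κ b hκ => ?_
    by_cases hs : ∑ i, κ i ^ 2 = μ
    · have hκb := hμ κ b hκ hs
      have hb : bigCurve a b α = μ := by
        rw [← hs, bigCurve]
        refine Finset.sum_congr rfl fun i _ => ?_
        rcases hκb i with h | h <;> rw [h]
        rw [neg_sq]
      exact inner_modeLp_eq_zero_of_neg hκb (congrFun hu ⟨b, hb⟩)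
    · exact inner_eq_zero_of_mem_iSup_kerPow ha hκ hs u.2
  -- Finiteness matters for the lower bound, since `finrank` is zero by default in infinite
  -- dimension.
  have hfin : Module.Finite ℂ E := Module.Finite.of_injective T hT
  rw [Nat.card_eq_fintype_card]
  refine le_antisymm ?_ ?_
  · refine (LinearMap.finrank_le_finrank_of_injective hT).trans ?_
    rw [Module.finrank_fintype_fun_eq_card]
  · have hmem : ∀ s : S, modeLp a (bigFreq a α s.1) s.1 ∈ E := fun s => by
      have := modeLp_mem_robinLaplacian ha (isRoot_bigFreq ha hL s.1)
      rw [show ∑ i, bigFreq a α s.1 i ^ 2 = μ from s.2] at this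
      exact mem_iSup_kerPow_of_eigen this
    -- Coinciding eigenvalues do no harm: modes of different parities are orthogonal.
    have hli : LinearIndependent ℂ fun s : S => (⟨_, hmem s⟩ : E) := by
      refine LinearIndependent.of_comp E.subtype ?_
      refine linearIndependent_of_ne_zero_of_inner_eq_zero (fun s => ?_) fun s t hst => ?_
      · exact modeLp_ne_zero (half_mem_box ha) (modeProd_bigFreq_ne_zero ha hL s.1)
      · exact inner_modeLp_of_ne ha fun h => hst (Subtype.ext h)
    exact hli.fintype_card_le_finrank

/-! ### Infinitely many eigencurves -/

/-- Frequencies of which the first `j` are large and the others stay bounded. -/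
def mixedFreq {d : ℕ} (a : Fin d → ℝ) (j : ℕ) (g : ℂ → ℂ) (α : ℂ) (i : Fin d) : ℂ :=
  if (i : ℕ) < j then bigFreq a α (fun _ => false) i else g (α * a i)⁻¹ / a i

lemma tendsto_inv_sectorAtInfty (φ l : ℝ) :
    Tendsto (fun α : ℂ => (α * l)⁻¹) (sectorAtInfty φ) (𝓝 0) := by
  have h : Tendsto (fun α : ℂ => α⁻¹ * (l : ℂ)⁻¹) (sectorAtInfty φ) (𝓝 (0 * (l : ℂ)⁻¹)) :=
    (tendsto_inv₀_cobounded.mono_left inf_le_left).mul_const _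
  simpa only [mul_inv, zero_mul] using h

lemma eventually_ne_zero_sectorAtInfty (φ : ℝ) : ∀ᶠ α in sectorAtInfty φ, α ≠ 0 := by
  filter_upwards [(tendsto_norm_sectorAtInfty φ).eventually_gt_atTop 0] with α h
  exact norm_pos_iff.1 h

lemma isEigencurve_mixedFreq {d : ℕ} {a : Fin d → ℝ} (ha : ∀ i, 0 < a i) {φ : ℝ}
    (hφ₀ : 0 < φ) (hφ : φ < Real.pi / 2) (j : ℕ) {g : ℂ → ℂ} (hg : AnalyticAt ℂ g 0)
    (hroot : ∀ᶠ w in 𝓝 (0 : ℂ), ∀ A, A * w = 1 → charFn false A (g w) = 0) :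
    IsEigencurve a φ fun α => ∑ i, mixedFreq a j g α i ^ 2 := by
  filter_upwards [eventually_all.2 fun i => eventually_isLarge hφ₀ hφ (ha i),
    eventually_all.2 fun i => (tendsto_inv_sectorAtInfty φ (a i)).eventually hroot,
    eventually_all.2 fun i => (tendsto_inv_sectorAtInfty φ (a i)).eventually
      hg.eventually_analyticAt, eventually_ne_zero_sectorAtInfty φ] with α h1 h2 h3 h4
  have ha' : ∀ i, (a i : ℂ) ≠ 0 := fun i => by exact_mod_cast (ha i).ne'
  -- All factors are even, so the mode equals `1` at the origin.
  refine ⟨isRobinEigenvalue_of_isRoot ha (b := fun _ => false) (x := 0) (fun i => ?_)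
    (fun i _ => ?_) ?_, ?_⟩
  · unfold mixedFreq
    split_ifs
    · exact isRoot_bigFreq_coordinate (ha i) (h1 i) false
    · rw [div_mul_cancel₀ _ (ha' i)]
      exact h2 i _ (mul_inv_cancel₀ (mul_ne_zero h4 (ha' i)))
  · exact ⟨by simpa using ha i, by simpa using ha i⟩
  · simp [modeProd, phase]
  · refine Finset.analyticAt_fun_sum _ fun i _ => AnalyticAt.pow ?_ 2
    unfold mixedFreq
    split_ifs
    · exact analyticAt_bigFreq (h1 i) _
    · have h5 : AnalyticAt ℂ (fun α : ℂ => (α * a i)⁻¹) α :=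
        AnalyticAt.inv (by fun_prop) (mul_ne_zero h4 (ha' i))
      exact ((h3 i).comp_of_eq h5 rfl).div_const

lemma tendsto_bounded_freq (φ l : ℝ) {g : ℂ → ℂ} (hg : ContinuousAt g 0) :
    Tendsto (fun α : ℂ => (g (α * l)⁻¹ / l) ^ 2) (sectorAtInfty φ) (𝓝 ((g 0 / l) ^ 2)) :=
  ((hg.tendsto.comp (tendsto_inv_sectorAtInfty φ l)).div_const _).pow 2

lemma mixedFreq_isEquivalent {d : ℕ} {a : Fin d → ℝ} (ha : ∀ i, 0 < a i) {φ : ℝ}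
    (hφ₀ : 0 < φ) (hφ : φ < Real.pi / 2) {j : ℕ} (hj : j ≠ 0) (hjd : j ≤ d) {g : ℂ → ℂ}
    (hg : ContinuousAt g 0) :
    (fun α => ∑ i, mixedFreq a j g α i ^ 2) ~[sectorAtInfty φ] fun α => -(j : ℂ) * α ^ 2 := by
  refine isEquivalent_of_isLittleO (by exact_mod_cast hj) ?_
  have h : ∀ i : Fin d, (fun α => mixedFreq a j g α i ^ 2 + if (i : ℕ) < j then α ^ 2 else 0)
      =o[sectorAtInfty φ] fun α => α ^ 2 := by
    intro i
    unfold mixedFreq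
    split_ifs with hi
    · exact bigFreq_sq_add_isLittleO ha hφ₀ hφ _ i
    · simp only [add_zero]
      refine ((tendsto_bounded_freq φ (a i) hg).isBigO_one ℂ).trans_isLittleO ?_
      rw [isLittleO_one_left_iff]
      simp only [norm_pow]
      exact (tendsto_pow_atTop two_ne_zero).comp (tendsto_norm_sectorAtInfty φ)
  refine (IsLittleO.sum (s := Finset.univ) fun i _ => h i).congr_left fun α => ?_
  rw [Finset.sum_apply, Finset.sum_add_distrib, Finset.sum_ite, Finset.sum_const_zero, add_zero,
    Finset.sum_const, Fin.card_filter_val_lt, min_eq_right hjd, nsmul_eq_mul]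

/-- The large frequencies are the same in both sums and cancel. The rest of the difference tends to
a nonzero multiple of a sum of `1 / a i ^ 2`, which is not empty since `j < d`. -/
lemma eventually_mixedFreq_ne {d : ℕ} {a : Fin d → ℝ} (ha : ∀ i, 0 < a i) {φ : ℝ} {j : ℕ}
    (hjd : j < d) {g g' : ℂ → ℂ} (hg : ContinuousAt g 0) (hg' : ContinuousAt g' 0)
    (hne : g 0 ^ 2 ≠ g' 0 ^ 2) : ∀ᶠ α in sectorAtInfty φ,
      ∑ i, mixedFreq a j g α i ^ 2 ≠ ∑ i, mixedFreq a j g' α i ^ 2 := by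
  have h : ∀ i : Fin d, Tendsto (fun α => mixedFreq a j g α i ^ 2 - mixedFreq a j g' α i ^ 2)
      (sectorAtInfty φ) (𝓝 ((g 0 ^ 2 - g' 0 ^ 2) *
        ((if (i : ℕ) < j then 0 else 1 / a i ^ 2 : ℝ) : ℂ))) := by
    intro i
    unfold mixedFreq
    split_ifs with hi
    · simp only [sub_self, Complex.ofReal_zero, mul_zero]
      exact tendsto_const_nhds
    · convert (tendsto_bounded_freq φ (a i) hg).sub
        (tendsto_bounded_freq φ (a i) hg') using 2
      push_cast
      ring
  have hsum := tendsto_finsetSum Finset.univ fun i _ => h i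
  have hpos : 0 < ∑ i : Fin d, if (i : ℕ) < j then (0 : ℝ) else 1 / a i ^ 2 := by
    refine Finset.sum_pos' (fun i _ => ?_) ⟨⟨j, hjd⟩, Finset.mem_univ _, ?_⟩
    · split_ifs
      · exact le_rfl
      · positivity
    · have := ha ⟨j, hjd⟩
      simp only [lt_irrefl, if_false]
      positivity
  rw [← Finset.mul_sum, ← Complex.ofReal_sum] at hsum
  filter_upwards [hsum.eventually_ne (mul_ne_zero (sub_ne_zero.2 hne)
    (Complex.ofReal_ne_zero.2 hpos.ne'))] with α hα
  rw [Finset.sum_sub_distrib] at hα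
  exact sub_ne_zero.1 hα

lemma tendsto_cobounded_of_isEquivalent {φ : ℝ} {f : ℂ → ℂ} {c : ℂ} (hc : c ≠ 0)
    (h : f ~[sectorAtInfty φ] fun α => c * α ^ 2) : Tendsto f (sectorAtInfty φ) (cobounded ℂ) := by
  rw [← tendsto_norm_atTop_iff_cobounded]
  refine h.isBigO_symm.trans_tendsto_norm_atTop ?_
  simp only [norm_mul, norm_pow]
  exact ((tendsto_pow_atTop two_ne_zero).comp (tendsto_norm_sectorAtInfty φ)).const_mul_atTop
    (norm_pos_iff.2 hc)

end RobinBox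

end

/-! ### Proof of the theorem. -/

theorem theorem8p3 (d : ℕ) (hd : 2 ≤ d) (a : Fin d → ℝ) (ha : ∀ i, 0 < a i)
    (φ : ℝ) (hφ₀ : 0 < φ) (hφ : φ < Real.pi / 2) :
    (∀ j : ℕ, 1 ≤ j → j ≤ d - 1 →
      ∃ lam : ℕ → ℂ → ℂ,
        (∀ n, RobinBox.IsEigencurve a φ (lam n) ∧
          Tendsto (lam n) (RobinBox.sectorAtInfty φ) (cobounded ℂ) ∧
          lam n ~[RobinBox.sectorAtInfty φ] fun α => -(j : ℂ) * α ^ 2) ∧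
        ∀ m n, m ≠ n → ∀ᶠ α in RobinBox.sectorAtInfty φ, lam m α ≠ lam n α) ∧
    ∃ lam : Fin (2 ^ d) → ℂ → ℂ,
      (∀ i, RobinBox.IsEigencurve a φ (lam i) ∧
        lam i ~[RobinBox.sectorAtInfty φ] fun α => -(d : ℂ) * α ^ 2) ∧
      (∀ᶠ α in RobinBox.sectorAtInfty φ, ∀ i,
        RobinBox.algMultiplicity a α (lam i α) = Nat.card {k // lam k α = lam i α}) ∧
      ∀ μ : ℂ → ℂ,
        (∀ᶠ α in RobinBox.sectorAtInfty φ, RobinBox.IsRobinEigenvalue a α (μ α)) →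
        (μ ~[RobinBox.sectorAtInfty φ] fun α => -(d : ℂ) * α ^ 2) →
        ∀ᶠ α in RobinBox.sectorAtInfty φ, ∃ i, μ α = lam i α := by
  have hd0 : d ≠ 0 := by omega
  refine ⟨fun j hj hjd => ?_, ?_⟩
  · choose g hg hg0 hroot using RobinBox.exists_analytic_bounded_root
    have hj0 : j ≠ 0 := by omega
    refine ⟨fun n α => ∑ i, RobinBox.mixedFreq a j (g n) α i ^ 2, fun n => ?_, fun m n hmn => ?_⟩
    · have h := RobinBox.mixedFreq_isEquivalent ha hφ₀ hφ hj0 (by omega) (hg n).continuousAt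
      exact ⟨RobinBox.isEigencurve_mixedFreq ha hφ₀ hφ j (hg n) (hroot n),
        RobinBox.tendsto_cobounded_of_isEquivalent (neg_ne_zero.2 (by exact_mod_cast hj0)) h, h⟩
    · refine RobinBox.eventually_mixedFreq_ne ha (by omega) (hg m).continuousAt
        (hg n).continuousAt ?_
      rw [hg0, hg0]
      norm_cast
      rw [sq_eq_sq₀ (by positivity) (by positivity), mul_left_inj' Real.pi_pos.ne', add_left_inj]
      exact_mod_cast hmn
  -- The curves are indexed by the parities of the `d` factors.
  · let e : Fin (2 ^ d) ≃ (Fin d → Bool) := (Fintype.equivFinOfCardEq (by simp)).symm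
    have hδ := RobinBox.tolerance_pos (d := d) hφ₀ hφ
    have hα := eventually_all.2 fun i => RobinBox.eventually_two_mul_norm_lt hφ₀ hφ (ha i)
    have hbig := RobinBox.eventually_eq_bigFreq ha hφ₀ hφ
    have hsq : ∀ {α : ℂ} {κ : Fin d → ℂ} {b : Fin d → Bool},
        (∀ i, κ i = RobinBox.bigFreq a α b i ∨ κ i = -RobinBox.bigFreq a α b i) →
        ∑ i, κ i ^ 2 = RobinBox.bigCurve a b α := fun h =>
      Finset.sum_congr rfl fun i _ => sq_eq_sq_iff_eq_or_eq_neg.2 (h i)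
    refine ⟨fun i => RobinBox.bigCurve a (e i), fun i =>
      ⟨RobinBox.isEigencurve_bigCurve ha hφ₀ hφ _, RobinBox.bigCurve_isEquivalent hd0 ha hφ₀ hφ _⟩,
      ?_, fun μ hμ hμ' => ?_⟩
    · filter_upwards [hα, hbig,
        eventually_all.2 fun i => RobinBox.eventually_isLarge hφ₀ hφ (ha i),
        eventually_all.2 fun b => RobinBox.eventually_norm_add_le hd0 hδ
          (RobinBox.bigCurve_isEquivalent hd0 ha hφ₀ hφ b)] with α h1 h2 h3 h4 i
      rw [RobinBox.algMultiplicity_eq_card ha h1 h3 fun κ b hκ hs => h2 κ b hκ (by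
        rw [hs]; exact h4 (e i))]
      exact Nat.card_congr (e.subtypeEquiv fun k => Iff.rfl).symm
    -- The threshold in `hbig` is uniform in `κ` and `b`, so the mode behind `μ α` may be chosen for
    -- each `α` separately and `μ` need not be continuous.
    · filter_upwards [hα, hbig, hμ, RobinBox.eventually_norm_add_le hd0 hδ hμ']
        with α h1 h2 h3 h4
      obtain ⟨κ, b, hκ, hs⟩ := RobinBox.exists_isRoot_of_isRobinEigenvalue ha h1 h3
      refine ⟨e.symm b, ?_⟩
      rw [e.apply_symm_apply, ← hsq (h2 κ b hκ (by rwa [hs])), hs]
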